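/- Let $D>1$ be a square-free integer, $K=\mathbb{Q}(\sqrt D)\subset\mathbb{R}$ (with $\sqrt D>0$), $\mathcal{O}_K$ its ring of integers, $a\mapsto\overline a$ Galois conjugation, and $\varepsilon>1$ the fundamental unit of $\mathcal{O}_K$, so that $\mathcal{O}_K^\times=\pm\varepsilon^{\mathbb Z}$. Identify $V_K=K\otimes_{\mathbb Q}\mathbb R$ with $\mathbb{R}^2$ by $a\otimes 1\mapsto(\overline a,a)$, write $\mathbf N(s,u)=|su|$, and let $\mathbb T_K=V_K/\mathcal{O}_K$, with the automorphism $\phi$ induced by multiplication by $\varepsilon$. For $P\in V_K$ put $M(P)=\inf_{Q\in\mathcal{O}_K}\mathbf N(P-Q)$; this descends to $\mathbb T_K$, and for $t\in\mathbb R$ we put $X_t=\{P\in\mathbb T_K: M(P)\ge t\}$. Let $\alpha=\frac{1+\sqrt D}{2}$ if $D\equiv1\pmod 4$ and $\alpha=\sqrt D$ otherwise, and let $R_0,R_1\subset\mathbb T_K$ be the images of the open planar rectangles $(0,-\overline{\alpha})\times(0,1)$ and $(-1,0)\times(0,\alpha)$; the union of these two planar rectangles is called the footprint. If $D=5$ let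 $\mathcal P_0=\{R_0,R_1\}$; otherwise let $\mathcal P_0$ be the set of connected components of the sets $A_0\cap\phi^{-1}(A_1)$ with $A_0,A_1\in\{R_0,R_1\}$. For $n\ge0$ let $\mathcal P_n$ be the set of all nonempty intersections $A=\bigcap_{i=-n}^{n}\phi^{-i}(A_i)$ with $A_i\in\mathcal P_0$; $A_{-n}\cdots A_n$ is the coordinate word of $A$. Let $\Sigma\subset\mathcal P_0^{\mathbb Z}$ be the set of strings $s$ with $s_i\cap\phi^{-1}(s_{i+1})\ne\emptyset$ for all $i\in\mathbb{Z}$, and let $\pi:\Sigma\to\mathbb T_K$ be the coding map sending $s$ to the unique point of $\bigcap_{n\ge0}\overline{\bigcap_{i=-n}^{n}\phi^{-i}(s_i)}$. For a collection $\mathcal C\subset\mathcal P_n$ let $\Sigma\langle\mathcal C\rangle$ be the set of $s\in\Sigma$ in which no coordinate word of a member of $\mathcal C$ occurs. For a finite set $I\subset\mathcal{O}_K$ and $t\in\mathbb R$ let $\mathcal U(t,I)=\bigcup_{Q\in I}\{P\in V_K:\mathbf N(P-Q)<t\}$, and let $\mathcal T_n(t,I)$ be the set of $A\in\mathcal P_n$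 such that the closure of the planar representative of $A$ contained in the footprint is a subset of $\mathcal U(t,I)$. Then there is a finite set $I_K\subset\mathcal{O}_K$ such that for every finite set $I$ with $I_K\subseteq I\subset\mathcal{O}_K$ the following hold. For all real $t'<t$ there is $n_0$ such that for all $n\ge n_0$ $$\pi^{-1}(X_t)\subseteq\Sigma\langle\mathcal T_n(t,I)\rangle\subseteq\pi^{-1}(X_{t'}).$$ In particular, for every $t\in\mathbb{R}$, $$\pi^{-1}(X_t)=\bigcap_{n\ge0}\Sigma\langle\mathcal T_n(t,I)\rangle.$$ -/

import Mathlib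

open Set Filter Topology

noncomputable section

namespace RealQuadraticTorus

/-! ### The field, its ring of integers and the plane -/

/-- The quadratic algebra `ℚ[ω]/(ω² - D)`, that is the field `K = ℚ(√D)` when `D` is not a square.
Elements are pairs `⟨re, im⟩`, standing for `re + im √D`. -/
abbrev K (D : ℕ) : Type := QuadraticAlgebra ℚ (D : ℚ) 0

/-- The ring of integers `𝒪_K`: the integral closure of `ℤ` in `K`. -/
abbrev OK (D : ℕ) : Subalgebra ℤ (K D) := integralClosure ℤ (K D)

/-- The plane `V_K = K ⊗ ℝ`, in the (stable, unstable) coordinates `(s, u)`. -/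
abbrev V : Type := ℝ × ℝ

/-- The canonical map `K → V_K`, `a ↦ (conjugate of a, a)`. -/
def embed (D : ℕ) : K D →+* V where
  toFun a := ((a.re : ℝ) - a.im * √D, (a.re : ℝ) + a.im * √D)
  map_one' := by simp [Prod.ext_iff, QuadraticAlgebra.re_one, QuadraticAlgebra.im_one]
  map_zero' := by simp
  map_add' a b := by
    ext <;> simp <;> ring
  map_mul' a b := by
    have h : √(D : ℝ) * √(D : ℝ) = D := Real.mul_self_sqrt (Nat.cast_nonneg D)
    ext <;> simp <;> linear_combination (-(a.im : ℝ) * b.im) * h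

/-- The absolute norm `𝐍(s, u) = |s u|` on `V_K`. -/
def absNorm (P : V) : ℝ := |P.1 * P.2|

/-- The lattice `𝒪_K ⊆ V_K`. -/
def lattice (D : ℕ) : AddSubgroup V :=
  (OK D).toSubring.toAddSubgroup.map (embed D : K D →+ V)

/-- The torus `𝕋_K = V_K / 𝒪_K`, with the quotient topology. -/
abbrev Torus (D : ℕ) : Type := V ⧸ lattice D

/-- The projection `V_K → 𝕋_K`. -/
def proj (D : ℕ) (P : V) : Torus D := (P : V ⧸ lattice D)

/-! ### The Euclidean minimum function and the sets `X_t` -/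

/-- `M(P) = inf_{Q ∈ 𝒪_K} 𝐍(P - Q)` for a point `P` of the plane. -/
def planeM (D : ℕ) (P : V) : ℝ := ⨅ Q : OK D, absNorm (P - embed D Q)

lemma planeM_eq_of_sub_mem (D : ℕ) {P P' : V} (h : -P + P' ∈ lattice D) :
    planeM D P = planeM D P' := by
  obtain ⟨q, hq, hqe⟩ := h
  have hqe' : embed D q = -P + P' := hqe
  unfold planeM
  refine Equiv.iInf_congr (Equiv.addRight (⟨q, hq⟩ : OK D)) fun Q => ?_
  have : P' - embed D ((Q + (⟨q, hq⟩ : OK D) : OK D) : K D) = P - embed D Q := by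
    rw [Subalgebra.coe_add, map_add, hqe']
    abel
  simpa using congrArg absNorm this

/-- The function `M` on the torus. -/
def M (D : ℕ) (P : Torus D) : ℝ :=
  Quotient.liftOn' P (planeM D) fun _ _ h =>
    planeM_eq_of_sub_mem D (QuotientAddGroup.leftRel_apply.mp h)

/-- `X_t = {P ∈ 𝕋_K | M(P) ≥ t}`. -/
def X (D : ℕ) (t : ℝ) : Set (Torus D) := {P | t ≤ M D P}

/-! ### The fundamental unit and the automorphism `φ` -/

/-- `ε` is the fundamental unit of `𝒪_K` with `ε > 1`: every unit is `± ε ^ k`. -/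
def IsFundamentalUnit (D : ℕ) (ε : (OK D)ˣ) : Prop :=
  1 < (embed D ((ε : OK D) : K D)).2 ∧ ∀ v : (OK D)ˣ, ∃ k : ℤ, v = ε ^ k ∨ v = -ε ^ k

/-- Multiplication by a unit, on the torus. -/
def unitMul (D : ℕ) (v : (OK D)ˣ) : Torus D →+ Torus D :=
  QuotientAddGroup.map (lattice D) (lattice D)
    (AddMonoidHom.mulLeft (embed D ((v : OK D) : K D))) (by
      rintro _ ⟨q, hq, rfl⟩
      exact ⟨((v : OK D) : K D) * q, (OK D).mul_mem (v : OK D).2 hq, map_mul (embed D) _ _⟩)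

lemma unitMul_mul_apply (D : ℕ) (v w : (OK D)ˣ) (h : v * w = 1) (P : Torus D) :
    unitMul D v (unitMul D w P) = P := by
  induction P using QuotientAddGroup.induction_on with
  | H P =>
    change ((embed D ((v : OK D) : K D) * (embed D ((w : OK D) : K D) * P) : V) : V ⧸ lattice D) = _
    have h1 : ((v : OK D) : K D) * ((w : OK D) : K D) = 1 := by
      have := congrArg (fun x : (OK D)ˣ => ((x : OK D) : K D)) h
      simpa using this
    rw [← mul_assoc, ← map_mul, h1, map_one, one_mul]

/-- The automorphism `φ` of `𝕋_K` induced by multiplication by `ε`. -/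
def phi (D : ℕ) (ε : (OK D)ˣ) : Equiv.Perm (Torus D) where
  toFun := unitMul D ε
  invFun := unitMul D ε⁻¹
  left_inv := unitMul_mul_apply D ε⁻¹ ε (inv_mul_cancel ε)
  right_inv := unitMul_mul_apply D ε ε⁻¹ (mul_inv_cancel ε)

/-! ### The Markov generator `𝒫₀` and its refinements -/

/-- `α_K`: the element `(1 + √D)/2` if `D ≡ 1 mod 4`, and `√D` otherwise. -/
def alpha (D : ℕ) : K D := if D % 4 = 1 then ⟨1 / 2, 1 / 2⟩ else ⟨0, 1⟩

/-- The open planar rectangle with corners `(0, 0)`, `(-conj α_K, 0)` and `(0, 1)`. -/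
def planeR₀ (D : ℕ) : Set V := Ioo 0 (-(embed D (alpha D)).1) ×ˢ Ioo 0 1

/-- The open planar rectangle with corners `(0, 0)`, `(-1, 0)` and `(0, α_K)`. -/
def planeR₁ (D : ℕ) : Set V := Ioo (-1) 0 ×ˢ Ioo 0 (embed D (alpha D)).2

/-- The two-rectangle Markov partition `{R₀, R₁}` of the torus. -/
def twoRect (D : ℕ) : Set (Set (Torus D)) := {proj D '' planeR₀ D, proj D '' planeR₁ D}

/-- The Markov generator `𝒫₀`: the partition `{R₀, R₁}` itself for `ℚ(√5)`, and for every other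
field the connected components of the intersections `A₀ ∩ φ⁻¹(A₁)` with `A₀, A₁ ∈ {R₀, R₁}`. -/
def P₀ (D : ℕ) (ε : (OK D)ˣ) : Set (Set (Torus D)) :=
  if D = 5 then twoRect D
  else {C | ∃ A₀ ∈ twoRect D, ∃ A₁ ∈ twoRect D, ∃ x ∈ A₀ ∩ phi D ε ⁻¹' A₁,
    C = connectedComponentIn (A₀ ∩ phi D ε ⁻¹' A₁) x}

/-- The alphabet: the members of `𝒫₀`. -/
abbrev Letter (D : ℕ) (ε : (OK D)ˣ) : Type := {A : Set (Torus D) // A ∈ P₀ D ε}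

/-- Words `A_{-n} ⋯ A_0 ⋯ A_n` in the alphabet `𝒫₀`. -/
abbrev Word (D : ℕ) (ε : (OK D)ˣ) (n : ℕ) : Type := Icc (-(n : ℤ)) (n : ℤ) → Letter D ε

/-- The intersection `φⁿ(A_{-n}) ∩ ⋯ ∩ A_0 ∩ ⋯ ∩ φ⁻ⁿ(A_n)`. -/
def wordSet {D : ℕ} {ε : (OK D)ˣ} {n : ℕ} (w : Word D ε n) : Set (Torus D) :=
  ⋂ i : Icc (-(n : ℤ)) (n : ℤ), (phi D ε ^ (i : ℤ)) ⁻¹' (w i : Set (Torus D))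

/-- The refinement `𝒫_n`: all nonempty sets `wordSet w`. -/
def P (D : ℕ) (ε : (OK D)ˣ) (n : ℕ) : Set (Set (Torus D)) :=
  {A | A.Nonempty ∧ ∃ w : Word D ε n, A = wordSet w}

/-- The planar representative of `A`, contained in the footprint `R₀ ∪ R₁`. -/
def planeRep (D : ℕ) (A : Set (Torus D)) : Set V :=
  proj D ⁻¹' A ∩ (planeR₀ D ∪ planeR₁ D)

/-! ### The symbolic coding -/

/-- `Σ`: the admissible bi-infinite strings, `AB` being admissible if `A ∩ φ⁻¹(B) ≠ ∅`. -/
def Sigma (D : ℕ) (ε : (OK D)ˣ) : Set (ℤ → Letter D ε) :=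
  {s | ∀ i : ℤ, ((s i : Set (Torus D)) ∩ phi D ε ⁻¹' (s (i + 1) : Set (Torus D))).Nonempty}

/-- The word of length `2n + 1` of the string `s` centred at `k`. -/
def window {D : ℕ} {ε : (OK D)ˣ} (s : ℤ → Letter D ε) (k : ℤ) (n : ℕ) : Word D ε n :=
  fun i => s (k + i)

/-- `π(s) = p`: the intersection over `n` of the closures of
`φⁿ(s_{-n}) ∩ ⋯ ∩ s_0 ∩ ⋯ ∩ φ⁻ⁿ(s_n)` is the single point `p`. -/
def IsCoded {D : ℕ} {ε : (OK D)ˣ} (s : ℤ → Letter D ε) (p : Torus D) : Prop :=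
  ⋂ n : ℕ, closure (wordSet (window s 0 n)) = {p}

/-- `π⁻¹(Y)`: the strings `s ∈ Σ` with `π(s) ∈ Y`. -/
def piPreimage (D : ℕ) (ε : (OK D)ˣ) (Y : Set (Torus D)) : Set (ℤ → Letter D ε) :=
  {s | s ∈ Sigma D ε ∧ ∃ p ∈ Y, IsCoded s p}

/-- `Σ⟨C⟩` for a collection `C` of members of `𝒫_n`: the strings in `Σ` in which no coordinate
word of a member of `C` occurs. -/
def sigmaAvoid (D : ℕ) (ε : (OK D)ˣ) (n : ℕ) (C : Set (Set (Torus D))) :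
    Set (ℤ → Letter D ε) :=
  {s | s ∈ Sigma D ε ∧ ∀ w : Word D ε n, wordSet w ∈ C → ∀ k : ℤ, window s k n ≠ w}

/-! ### Trapped rectangles -/

/-- `𝒰(t, I)`: the points of the plane at norm-distance less than `t` from a point of `I`. -/
def U (D : ℕ) (t : ℝ) (I : Finset (OK D)) : Set V :=
  ⋃ Q ∈ I, {P : V | absNorm (P - embed D Q) < t}

/-- `𝒯_n(t, I)`: the members of `𝒫_n` whose closure (in the plane) is contained in `𝒰(t, I)`. -/
def T (D : ℕ) (ε : (OK D)ˣ) (n : ℕ) (t : ℝ) (I : Finset (OK D)) : Set (Set (Torus D)) :=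
  {A | A ∈ P D ε n ∧ closure (planeRep D A) ⊆ U D t I}

end RealQuadraticTorus

end

/-!
Modulo `𝒪_K`, the unstable sides of `R₀` and `R₁` lie in one segment issuing from the origin and
the stable sides in another, and both segments avoid the translates of the open rectangles. Since
`ε⁻¹` contracts the first and `ε` the second into itself, each transition between letters stretches
rectangles across rectangles. The translate realizing a transition is unique: for `D = 5` because
`ε ≤ α`, otherwise because the letters are connected. So admissible words have nonempty cylinders
of diameter `O(ε⁻ⁿ)`, and every admissible string codes a point.

If the coded point has `M ≥ t`, so do all its iterates, and none of them lies in the closure of a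
trapped cylinder. Conversely, if `M < t'` at a point `P`, take `Q ∈ 𝒪_K` with `𝐍(P - Q) < t'`.
Multiplication by a power of `ε` balances the two coordinates of `P - Q` and keeps the norm, so at
some iterate the witness lies in a fixed finite set `I_K` and at bounded distance. There `𝐍` varies
by less than `t - t'` over a small cylinder, which is therefore trapped.
-/

noncomputable section

namespace RealQuadraticTorus

/-! ### Algebraic integers and units in the plane -/

/-- The real number `α`, the height of the rectangle `R₁`. -/
def α (D : ℕ) : ℝ := (embed D (alpha D)).2

/-- The real number `β = -conj α`, the width of the rectangle `R₀`. -/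
def β (D : ℕ) : ℝ := -(embed D (alpha D)).1

lemma exists_int_of_isIntegral_algebraMap {D : ℕ} {r : ℚ}
    (h : IsIntegral ℤ (algebraMap ℚ (K D) r)) : ∃ m : ℤ, (m : ℚ) = r := by
  rw [isIntegral_algebraMap_iff QuadraticAlgebra.algebraMap_injective] at h
  obtain ⟨m, hm⟩ := IsIntegrallyClosed.isIntegral_iff.1 h
  exact ⟨m, by simpa using hm⟩

lemma isIntegral_star {D : ℕ} {x : K D} (hx : x ∈ OK D) : IsIntegral ℤ (star x) := by
  have hx : IsIntegral ℤ x := hx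
  simpa [starRingEnd_apply] using hx.map (starRingEnd (K D)).toIntAlgHom

lemma exists_int_eq_trace {D : ℕ} {x : K D} (hx : x ∈ OK D) : ∃ m : ℤ, (m : ℚ) = 2 * x.re := by
  apply exists_int_of_isIntegral_algebraMap (D := D)
  have h := IsIntegral.add hx (isIntegral_star hx)
  rw [← QuadraticAlgebra.algebraMap_trace_eq_add_star] at h
  simpa [QuadraticAlgebra.trace_def] using h

lemma exists_int_eq_norm {D : ℕ} {x : K D} (hx : x ∈ OK D) :
    ∃ k : ℤ, (k : ℚ) = x.re ^ 2 - D * x.im ^ 2 := by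
  apply exists_int_of_isIntegral_algebraMap (D := D)
  have h := IsIntegral.mul hx (isIntegral_star hx)
  rw [← QuadraticAlgebra.algebraMap_norm_eq_mul_star, QuadraticAlgebra.norm_def] at h
  convert h using 2
  ring

lemma exists_int_of_squarefree_mul_sq {D : ℕ} (hsq : Squarefree D) {q : ℚ} {k : ℤ}
    (h : (D : ℚ) * q ^ 2 = k) : ∃ n : ℤ, (n : ℚ) = q := by
  have hD : (D : ℚ) ≠ 0 := Nat.cast_ne_zero.2 hsq.ne_zero
  have hpow : ((D : ℚ) * q) ^ 2 = algebraMap ℤ ℚ (D * k) := by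
    simp only [eq_intCast, Int.cast_mul, Int.cast_natCast, ← h]
    ring
  obtain ⟨z, hz⟩ := IsIntegrallyClosed.exists_algebraMap_eq_of_isIntegral_pow two_pos
    (hpow ▸ isIntegral_algebraMap)
  have hz : (z : ℚ) = D * q := hz
  have hdvd : (D : ℤ) ∣ z ^ 2 := ⟨k, by
    rw [← hz, eq_intCast] at hpow
    exact_mod_cast hpow⟩
  obtain ⟨n, rfl⟩ := (Squarefree.dvd_pow_iff_dvd (Int.squarefree_natCast.2 hsq) two_ne_zero).1 hdvd
  exact ⟨n, mul_left_cancel₀ hD (by simpa using hz)⟩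

lemma even_sub_of_even_sq_sub {d m n : ℤ} (hd : Odd d) (h : Even (m ^ 2 - d * n ^ 2)) :
    Even (m - n) := by
  have hd' := Int.not_even_iff_odd.2 hd
  simpa [Int.even_sub, Int.even_mul, Int.even_pow, hd'] using h

lemma even_and_even_of_four_dvd_sq_sub {d m n : ℤ} (hd : d % 4 = 2 ∨ d % 4 = 3)
    (h : 4 ∣ m ^ 2 - d * n ^ 2) : Even m ∧ Even n := by
  have key : ∀ d m n : ZMod 4, (d = 2 ∨ d = 3) → m ^ 2 - d * n ^ 2 = 0 → 2 * m = 0 ∧ 2 * n = 0 := by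
    decide
  have even_of {a : ℤ} (ha : (2 * a : ZMod 4) = 0) : Even a := by
    have : ((4 : ℕ) : ℤ) ∣ 2 * a := (ZMod.intCast_zmod_eq_zero_iff_dvd _ 4).1 (mod_cast ha)
    exact Int.even_iff.2 (by omega)
  have hd' : (d : ZMod 4) = 2 ∨ (d : ZMod 4) = 3 := by
    refine hd.imp (fun hd => ?_) fun hd => ?_
    exacts [(ZMod.intCast_eq_intCast_iff' d 2 4).2 hd, (ZMod.intCast_eq_intCast_iff' d 3 4).2 hd]
  obtain ⟨hm, hn⟩ := key d m n hd' (mod_cast (ZMod.intCast_zmod_eq_zero_iff_dvd _ 4).2 h)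
  exact ⟨even_of hm, even_of hn⟩

lemma exists_eq_add_mul_alpha {D : ℕ} (hsq : Squarefree D) {x : K D} (hx : x ∈ OK D) :
    ∃ m n : ℤ, x = m + n * alpha D := by
  obtain ⟨m, hm⟩ := exists_int_eq_trace hx
  obtain ⟨k, hk⟩ := exists_int_eq_norm hx
  obtain ⟨n, hn⟩ := exists_int_of_squarefree_mul_sq hsq (q := 2 * x.im) (k := m ^ 2 - 4 * k) (by
    push_cast; rw [hm, hk]; ring)
  have hre : x.re = m / 2 := by linarith
  have him : x.im = n / 2 := by linarith
  have hnorm : m ^ 2 - D * n ^ 2 = 4 * k := by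
    rw [hre, him] at hk
    exact_mod_cast (by linarith : ((m : ℚ) ^ 2 - D * n ^ 2) = 4 * k)
  by_cases h1 : D % 4 = 1
  · obtain ⟨a, ha⟩ := even_sub_of_even_sq_sub (d := D) (m := m) (n := n)
      (Int.odd_iff.2 (by omega)) (hnorm ▸ Int.even_iff.2 (by omega))
    refine ⟨a, n, ?_⟩
    have hma : (m : ℚ) = a + a + n := by exact_mod_cast (by linarith : m = a + a + n)
    rw [alpha, if_pos h1]
    ext
    · simp [hre, hma]; ring
    · simp [him]; ring
  · have h4 : D % 4 ≠ 0 := fun h0 => by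
      simpa using hsq 2 (Nat.dvd_of_mod_eq_zero h0)
    obtain ⟨⟨a, rfl⟩, b, rfl⟩ := even_and_even_of_four_dvd_sq_sub (d := D) (by omega) ⟨k, hnorm⟩
    refine ⟨a, b, ?_⟩
    rw [alpha, if_neg h1]
    ext
    · simp [hre]
    · simp [him]

lemma alpha_mem (D : ℕ) : alpha D ∈ OK D := by
  change IsIntegral ℤ _
  unfold alpha
  split_ifs with h
  · obtain ⟨j, hj⟩ : ∃ j : ℕ, D = 4 * j + 1 := ⟨D / 4, by omega⟩
    have hj : (D : ℚ) = 4 * j + 1 := by exact_mod_cast hj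
    refine ⟨Polynomial.X ^ 2 - Polynomial.X - Polynomial.C (j : ℤ), by monicity!, ?_⟩
    ext
    · simp [sq, hj]; ring
    · simp [sq]; ring
  · refine ⟨Polynomial.X ^ 2 - Polynomial.C (D : ℤ), by monicity!, ?_⟩
    ext <;> simp [sq]

lemma one_lt_α_and_β_bounds {D : ℕ} (hD : 1 < D) :
    1 < α D ∧ 0 < β D ∧ β D ≤ α D ∧ 1 ≤ α D * β D := by
  have hs : √(D : ℝ) * √(D : ℝ) = D := Real.mul_self_sqrt (Nat.cast_nonneg D)
  have h1 : 1 < √(D : ℝ) := Real.lt_sqrt_of_sq_lt (by simpa using hD)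
  by_cases h : D % 4 = 1
  · have h5 : (5 : ℝ) ≤ D := by exact_mod_cast (by omega : 5 ≤ D)
    have hα : α D = (1 + √D) / 2 := by simp [α, alpha, h, embed]; ring
    have hβ : β D = (√D - 1) / 2 := by simp [β, alpha, h, embed]; ring
    rw [hα, hβ]
    refine ⟨?_, ?_, ?_, ?_⟩ <;> linarith
  · have hα : α D = √D := by simp [α, alpha, h, embed]
    have hβ : β D = √D := by simp [β, alpha, h, embed]
    rw [hα, hβ]
    exact ⟨h1, by linarith, le_rfl, one_le_mul_of_one_le_of_one_le h1.le h1.le⟩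

lemma one_lt_α {D : ℕ} (hD : 1 < D) : 1 < α D := (one_lt_α_and_β_bounds hD).1

lemma β_pos {D : ℕ} (hD : 1 < D) : 0 < β D := (one_lt_α_and_β_bounds hD).2.1

lemma β_le_α {D : ℕ} (hD : 1 < D) : β D ≤ α D := (one_lt_α_and_β_bounds hD).2.2.1

lemma one_le_α_mul_β {D : ℕ} (hD : 1 < D) : 1 ≤ α D * β D := (one_lt_α_and_β_bounds hD).2.2.2

lemma α_five : α 5 = (1 + √5) / 2 := by simp [α, alpha, embed]; ring

lemma β_five : β 5 = (√5 - 1) / 2 := by simp [β, alpha, embed]; ring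

lemma embed_mem_lattice {D : ℕ} {x : K D} (hx : x ∈ OK D) : embed D x ∈ lattice D :=
  ⟨x, hx, rfl⟩

lemma embed_injective {D : ℕ} (hD : D ≠ 0) : Function.Injective (embed D) := by
  intro x y h
  have h1 : (x.re : ℝ) - x.im * √D = y.re - y.im * √D := congrArg Prod.fst h
  have h2 : (x.re : ℝ) + x.im * √D = y.re + y.im * √D := congrArg Prod.snd h
  have hs : √(D : ℝ) ≠ 0 := by positivity
  have him : (x.im : ℝ) = y.im := mul_right_cancel₀ hs (by linarith)
  ext
  · exact_mod_cast (by linarith : (x.re : ℝ) = y.re)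
  · exact_mod_cast him

/-- The lattice in the plane spanned by `(1, 1)` and `(-b, a)`. -/
def grid (a b : ℝ) : AddSubgroup V := AddSubgroup.closure {(1, 1), (-b, a)}

lemma mem_grid {a b : ℝ} {c : V} :
    c ∈ grid a b ↔ ∃ m n : ℤ, c = ((m : ℝ) - n * b, (m : ℝ) + n * a) := by
  simp [grid, AddSubgroup.mem_closure_pair, eq_comm, sub_eq_add_neg]

lemma lattice_eq_grid {D : ℕ} (hsq : Squarefree D) : lattice D = grid (α D) (β D) := by
  apply le_antisymm
  · rintro _ ⟨x, hx, rfl⟩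
    obtain ⟨m, n, rfl⟩ := exists_eq_add_mul_alpha hsq hx
    refine mem_grid.2 ⟨m, n, ?_⟩
    change embed D _ = _
    ext <;> simp [α, β]
  · rw [grid, AddSubgroup.closure_le, insert_subset_iff, singleton_subset_iff]
    constructor
    · exact ⟨1, (OK D).one_mem, map_one (embed D)⟩
    · simpa [α, β] using embed_mem_lattice (alpha_mem D)

/-- The image in the plane of a unit of `𝒪_K`. -/
def unitPt (D : ℕ) : (OK D)ˣ →* V :=
  (embed D : K D →* V).comp ((OK D).val.toMonoidHom.comp (Units.coeHom (OK D)))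

lemma unitPt_mem_lattice {D : ℕ} (v : (OK D)ˣ) : unitPt D v ∈ lattice D :=
  embed_mem_lattice (v : OK D).2

lemma unitPt_mul_mem_lattice {D : ℕ} (v : (OK D)ˣ) {c : V} (hc : c ∈ lattice D) :
    unitPt D v * c ∈ lattice D := by
  obtain ⟨x, hx, rfl⟩ := hc
  exact ⟨((v : OK D) : K D) * x, (OK D).mul_mem (v : OK D).2 hx, map_mul (embed D) _ _⟩

lemma unitPt_neg {D : ℕ} (v : (OK D)ˣ) : unitPt D (-v) = -unitPt D v := by
  change embed D _ = -embed D _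
  simp

lemma exists_int_eq_fst_mul_snd {D : ℕ} {c : V} (hc : c ∈ lattice D) : ∃ k : ℤ, c.1 * c.2 = k := by
  obtain ⟨x, hx, rfl⟩ := hc
  obtain ⟨k, hk⟩ := exists_int_eq_norm hx
  have hs : √(D : ℝ) * √(D : ℝ) = D := Real.mul_self_sqrt (Nat.cast_nonneg D)
  refine ⟨k, ?_⟩
  rw [← Rat.cast_intCast, hk]
  change ((x.re : ℝ) - x.im * √D) * ((x.re : ℝ) + x.im * √D) = _
  push_cast
  linear_combination (-(x.im : ℝ) ^ 2) * hs

lemma abs_fst_mul_abs_snd_unitPt {D : ℕ} (v : (OK D)ˣ) :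
    |(unitPt D v).1| * |(unitPt D v).2| = 1 := by
  obtain ⟨k, hk⟩ := exists_int_eq_fst_mul_snd (unitPt_mem_lattice v)
  obtain ⟨l, hl⟩ := exists_int_eq_fst_mul_snd (unitPt_mem_lattice v⁻¹)
  have h : unitPt D v * unitPt D v⁻¹ = 1 := by rw [← map_mul, mul_inv_cancel, map_one]
  have hkl : k * l = 1 := by
    have h' : ((unitPt D v).1 * (unitPt D v⁻¹).1) * ((unitPt D v).2 * (unitPt D v⁻¹).2) = 1 := by
      rw [← Prod.fst_mul, ← Prod.snd_mul, h, Prod.fst_one, Prod.snd_one, mul_one]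
    rw [mul_mul_mul_comm, hk, hl] at h'
    exact_mod_cast h'
  rw [← abs_mul, hk]
  rcases Int.eq_one_or_neg_one_of_mul_eq_one hkl with rfl | rfl <;> simp

lemma absNorm_unitPt_mul {D : ℕ} (v : (OK D)ˣ) (P : V) :
    absNorm (unitPt D v * P) = absNorm P := by
  rw [absNorm, absNorm, Prod.fst_mul, Prod.snd_mul, mul_mul_mul_comm, abs_mul, abs_mul,
    abs_fst_mul_abs_snd_unitPt, one_mul]

lemma abs_fst_unitPt {D : ℕ} {v : (OK D)ˣ} (h : 1 < (unitPt D v).2) :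
    |(unitPt D v).1| = ((unitPt D v).2)⁻¹ := by
  have := abs_fst_mul_abs_snd_unitPt v
  rw [abs_of_pos (zero_lt_one.trans h)] at this
  exact eq_inv_of_mul_eq_one_left this

lemma abs_fst_unitPt_lt_one {D : ℕ} {v : (OK D)ˣ} (h : 1 < (unitPt D v).2) :
    |(unitPt D v).1| < 1 :=
  abs_fst_unitPt h ▸ inv_lt_one_of_one_lt₀ h

lemma α_le_snd_unitPt_of_fst_neg {D : ℕ} (hD : 1 < D) (hsq : Squarefree D) {v : (OK D)ˣ}
    (h : 1 < (unitPt D v).2) (h1 : (unitPt D v).1 < 0) : α D ≤ (unitPt D v).2 := by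
  obtain ⟨m, n, hmn⟩ := mem_grid.1 (lattice_eq_grid hsq ▸ unitPt_mem_lattice v)
  have hlt := (abs_lt.1 (abs_fst_unitPt_lt_one h)).1
  have hα := one_lt_α hD
  have hβ := β_pos hD
  rw [hmn] at h h1 hlt ⊢
  have hn : (1 : ℝ) ≤ n := Int.cast_one_le_of_pos (by
    have : (0 : ℝ) < n * (α D + β D) := by linarith
    exact_mod_cast pos_of_mul_pos_left this (by linarith))
  have hm : (0 : ℝ) ≤ m := by
    have : (-1 : ℝ) < m := by nlinarith
    exact_mod_cast (by exact_mod_cast this : -1 < m)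
  dsimp only
  nlinarith

lemma IsFundamentalUnit.snd_unitPt_le {D : ℕ} {ε : (OK D)ˣ} (hε : IsFundamentalUnit D ε)
    {v : (OK D)ˣ} (hv : 1 < (unitPt D v).2) : (unitPt D ε).2 ≤ (unitPt D v).2 := by
  have h1 : 1 < (unitPt D ε).2 := hε.1
  have h0 : 0 < (unitPt D ε).2 := zero_lt_one.trans h1
  obtain ⟨k, rfl | rfl⟩ := hε.2 v
  · rw [map_zpow, Prod.pow_snd] at hv ⊢
    have hk : 1 ≤ k := (one_lt_zpow_iff_right₀ h1).1 hv
    simpa using zpow_le_zpow_right₀ h1.le hk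
  · rw [unitPt_neg, map_zpow, Prod.snd_neg, Prod.pow_snd] at hv
    linarith [zpow_pos h0 k]

lemma IsFundamentalUnit.snd_unitPt_le_α {ε : (OK 5)ˣ} (hε : IsFundamentalUnit 5 ε) :
    (unitPt 5 ε).2 ≤ α 5 := by
  have hmul : alpha 5 * (alpha 5 - 1) = 1 := by
    ext <;> simp [alpha, QuadraticAlgebra.re_one, QuadraticAlgebra.im_one] <;> norm_num
  let a : (OK 5)ˣ := Units.mkOfMulEqOne ⟨alpha 5, alpha_mem 5⟩
    ⟨alpha 5 - 1, (OK 5).sub_mem (alpha_mem 5) (OK 5).one_mem⟩ (Subtype.ext hmul)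
  exact hε.snd_unitPt_le (v := a) (one_lt_α (by norm_num))

/-! ### Lattice translates of the two rectangles -/

/-- Left ends of the stable sides of the two base rectangles, `false` standing for `R₀` and `true`
for `R₁`. -/
def rectLeft : Bool → ℝ
  | false => 0
  | true => -1

/-- Right ends of the stable sides of the two base rectangles, when `R₀` has width `b`. -/
def rectRight (b : ℝ) : Bool → ℝ
  | false => b
  | true => 0

/-- Upper ends of the unstable sides of the two base rectangles, when `R₁` has height `a`. -/
def rectTop (a : ℝ) : Bool → ℝ
  | false => 1
  | true => a

/-- The two rectangles `(0, b) × (0, 1)` and `(-1, 0) × (0, a)`, for which `ℝ² / grid a b` has the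
two-rectangle partition. -/
def rect (a b : ℝ) (i : Bool) : Set V :=
  Ioo (rectLeft i) (rectRight b i) ×ˢ Ioo 0 (rectTop a i)

section Grid

variable {a b : ℝ}

lemma one_le_intCast_of_pos {m : ℤ} (h : 0 < (m : ℝ)) : (1 : ℝ) ≤ m :=
  Int.cast_one_le_of_pos (Int.cast_pos.1 h)

lemma intCast_le_neg_one_of_neg {m : ℤ} (h : (m : ℝ) < 0) : (m : ℝ) ≤ -1 :=
  Int.cast_le_neg_one_of_neg (Int.cast_lt_zero.1 h)

lemma intCast_nonneg_of_neg_one_lt {m : ℤ} (h : -1 < (m : ℝ)) : (0 : ℝ) ≤ m := by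
  have : -1 < m := by exact_mod_cast h
  exact_mod_cast Int.lt_iff_add_one_le.1 this

lemma intCast_nonpos_of_lt_one {m : ℤ} (h : (m : ℝ) < 1) : (m : ℝ) ≤ 0 := by
  have : m < 1 := by exact_mod_cast h
  exact_mod_cast Int.lt_add_one_iff.1 this

lemma eq_zero_of_mem_grid (ha : 0 ≤ a) (hb : 0 < b) {c : V} (hc : c ∈ grid a b)
    (h1 : |c.1| < 1) (h2 : |c.1| + |c.2| < a + b) : c = 0 := by
  obtain ⟨m, n, rfl⟩ := mem_grid.1 hc
  dsimp only at h1 h2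
  have hn : n = 0 := by
    have : |(n : ℝ)| * (a + b) < 1 * (a + b) := by
      rw [← abs_of_nonneg (add_nonneg ha hb.le), ← abs_mul,
        show (n : ℝ) * (a + b) = (m + n * a) - (m - n * b) by ring, one_mul,
        abs_of_nonneg (add_nonneg ha hb.le)]
      linarith [abs_sub (m + n * a) (m - n * b)]
    exact Int.abs_lt_one_iff.1 (by exact_mod_cast lt_of_mul_lt_mul_right this (by positivity))
  subst hn
  have hm : m = 0 := Int.abs_lt_one_iff.1 (by exact_mod_cast (by simpa using h1 : |(m : ℝ)| < 1))
  simp [hm]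

lemma notMem_rect_true_of_mem_rect_false (ha : 0 ≤ a) (hb : 0 ≤ b) {P Q : V} (h : Q - P ∈ grid a b)
    (hP : P ∈ rect a b false) : Q ∉ rect a b true := by
  intro hQ
  obtain ⟨m, n, hmn⟩ := mem_grid.1 h
  obtain rfl : Q = P + ((m : ℝ) - n * b, (m : ℝ) + n * a) := eq_add_of_sub_eq' hmn
  obtain ⟨⟨hx0, hx1⟩, hy0, hy1⟩ := hP
  obtain ⟨⟨hx0', hx1'⟩, hy0', hy1'⟩ := hQ
  simp only [rectLeft, rectRight, rectTop, Prod.fst_add, Prod.snd_add] at *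
  obtain hn | hn := le_or_gt (n : ℝ) 0
  · have hm : (m : ℝ) ≤ -1 := intCast_le_neg_one_of_neg (by nlinarith)
    nlinarith
  · have hn := one_le_intCast_of_pos hn
    have hm : (m : ℝ) ≤ -1 := intCast_le_neg_one_of_neg (by nlinarith)
    nlinarith

lemma eq_of_mem_rect_of_sub_mem_grid (ha : 0 ≤ a) (hb : 0 ≤ b) {i : Bool} {P Q : V}
    (h : Q - P ∈ grid a b) (hP : P ∈ rect a b i) (hQ : Q ∈ rect a b i) : P = Q := by
  obtain ⟨m, n, hmn⟩ := mem_grid.1 h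
  obtain rfl : Q = P + ((m : ℝ) - n * b, (m : ℝ) + n * a) := eq_add_of_sub_eq' hmn
  obtain ⟨⟨hx0, hx1⟩, hy0, hy1⟩ := hP
  obtain ⟨⟨hx0', hx1'⟩, hy0', hy1'⟩ := hQ
  simp only [Prod.fst_add, Prod.snd_add] at hx0' hx1' hy0' hy1'
  obtain hn | hn | hn := lt_trichotomy (n : ℝ) 0
  · exfalso
    have hn := intCast_le_neg_one_of_neg hn
    cases i <;> simp only [rectLeft, rectRight, rectTop] at *
    · have hm := intCast_le_neg_one_of_neg (m := m) (by nlinarith)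
      nlinarith
    · have hm := one_le_intCast_of_pos (m := m) (by nlinarith)
      nlinarith
  · have hm : m = 0 := Int.abs_lt_one_iff.1 (by
      have : |(m : ℝ)| < 1 := by
        cases i <;> simp only [rectLeft, rectRight, rectTop, hn] at * <;>
          exact abs_lt.2 ⟨by linarith, by linarith⟩
      exact_mod_cast this)
    simp [hm, hn]
  · exfalso
    have hn := one_le_intCast_of_pos hn
    cases i <;> simp only [rectLeft, rectRight, rectTop] at *
    · have hm := one_le_intCast_of_pos (m := m) (by nlinarith)
      nlinarith
    · have hm := intCast_le_neg_one_of_neg (m := m) (by nlinarith)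
      nlinarith

lemma rect_translate_unique (ha : 0 ≤ a) (hb : 0 ≤ b) {i j : Bool} {P Q : V}
    (h : Q - P ∈ grid a b) (hP : P ∈ rect a b i) (hQ : Q ∈ rect a b j) : i = j ∧ P = Q := by
  have h' : P - Q ∈ grid a b := neg_sub Q P ▸ neg_mem h
  cases i <;> cases j
  · exact ⟨rfl, eq_of_mem_rect_of_sub_mem_grid ha hb h hP hQ⟩
  · exact absurd hQ (notMem_rect_true_of_mem_rect_false ha hb h hP)
  · exact absurd hP (notMem_rect_true_of_mem_rect_false ha hb h' hQ)
  · exact ⟨rfl, eq_of_mem_rect_of_sub_mem_grid ha hb h hP hQ⟩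

lemma unstable_segment_add_notMem_rect (ha : 0 ≤ a) (hb : 0 ≤ b) {i : Bool} {w : ℝ}
    (hw : w ∈ Icc 0 (1 + a)) {c : V} (hc : c ∈ grid a b) : ((0, w) : V) + c ∉ rect a b i := by
  obtain ⟨m, n, rfl⟩ := mem_grid.1 hc
  obtain ⟨hw0, hw1⟩ := hw
  rintro ⟨⟨hx0, hx1⟩, hy0, hy1⟩
  cases i <;> simp only [rectLeft, rectRight, rectTop, Prod.fst_add, Prod.snd_add] at *
  · obtain hn | hn := le_or_gt 0 (n : ℝ)
    · have hm := one_le_intCast_of_pos (m := m) (by nlinarith)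
      nlinarith
    · have hn := intCast_le_neg_one_of_neg hn
      have hm := intCast_le_neg_one_of_neg (m := m) (by nlinarith)
      nlinarith
  · obtain hn | hn := le_or_gt (n : ℝ) 0
    · have hm := intCast_le_neg_one_of_neg (m := m) (by nlinarith)
      have hn0 := intCast_le_neg_one_of_neg (m := n) (by nlinarith)
      nlinarith
    · have hn := one_le_intCast_of_pos hn
      have hm := intCast_nonneg_of_neg_one_lt (m := m) (by nlinarith)
      nlinarith

lemma stable_segment_add_notMem_rect (ha : 0 ≤ a) (hb : 0 ≤ b) {i : Bool} {x : ℝ}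
    (hx : x ∈ Icc (-1) b) {c : V} (hc : c ∈ grid a b) : ((x, 0) : V) + c ∉ rect a b i := by
  obtain ⟨m, n, rfl⟩ := mem_grid.1 hc
  obtain ⟨hxl, hxr⟩ := hx
  rintro ⟨⟨hx0, hx1⟩, hy0, hy1⟩
  cases i <;> simp only [rectLeft, rectRight, rectTop, Prod.fst_add, Prod.snd_add] at *
  · obtain hn | hn := le_or_gt 0 (n : ℝ)
    · have hm := intCast_nonpos_of_lt_one (m := m) (by nlinarith)
      have hn := one_le_intCast_of_pos (m := n) (by nlinarith)
      nlinarith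
    · have hn := intCast_le_neg_one_of_neg hn
      have hm := one_le_intCast_of_pos (m := m) (by nlinarith)
      nlinarith
  · obtain hn | hn := le_or_gt (n : ℝ) 0
    · have hm := one_le_intCast_of_pos (m := m) (by nlinarith)
      nlinarith
    · have hn := one_le_intCast_of_pos hn
      have hm := intCast_le_neg_one_of_neg (m := m) (by nlinarith)
      nlinarith

lemma exists_eq_unstable_segment_add (ha : 0 ≤ a) {i : Bool} {x y : ℝ}
    (hx : x = rectLeft i ∨ x = rectRight b i) (hy : y ∈ Ioo 0 (rectTop a i)) :
    ∃ w ∈ Icc 0 (1 + a), ∃ c ∈ grid a b, ((x, y) : V) = (0, w) + c := by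
  have h11 : ((1, 1) : V) ∈ grid a b := AddSubgroup.subset_closure (by simp)
  have hba : ((-b, a) : V) ∈ grid a b := AddSubgroup.subset_closure (by simp)
  obtain ⟨hy0, hy1⟩ := hy
  cases i <;> simp only [rectLeft, rectRight, rectTop] at hx hy1 <;> rcases hx with rfl | rfl
  · exact ⟨y, ⟨by linarith, by linarith⟩, 0, zero_mem _, by simp⟩
  · exact ⟨y + a, ⟨by linarith, by linarith⟩, _, neg_mem hba, by simp⟩
  · exact ⟨y + 1, ⟨by linarith, by linarith⟩, _, neg_mem h11, by simp⟩
  · exact ⟨y, ⟨by linarith, by linarith⟩, 0, zero_mem _, by simp⟩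

lemma exists_eq_stable_segment_add (hb : 0 ≤ b) {i : Bool} {x y : ℝ}
    (hx : x ∈ Ioo (rectLeft i) (rectRight b i)) (hy : y = 0 ∨ y = rectTop a i) :
    ∃ j ∈ Icc (-1) b, ∃ c ∈ grid a b, ((x, y) : V) = (j, 0) + c := by
  have h11 : ((1, 1) : V) ∈ grid a b := AddSubgroup.subset_closure (by simp)
  have hba : ((-b, a) : V) ∈ grid a b := AddSubgroup.subset_closure (by simp)
  obtain ⟨hx0, hx1⟩ := hx
  cases i <;> simp only [rectLeft, rectRight, rectTop] at hx0 hx1 hy <;> rcases hy with rfl | rfl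
  · exact ⟨x, ⟨by linarith, by linarith⟩, 0, zero_mem _, by simp⟩
  · exact ⟨x - 1, ⟨by linarith, by linarith⟩, _, h11, by simp⟩
  · exact ⟨x, ⟨by linarith, by linarith⟩, 0, zero_mem _, by simp⟩
  · exact ⟨x + b, ⟨by linarith, by linarith⟩, _, hba, by simp⟩

end Grid

/-! ### The Markov property -/

/-- The base rectangles of the torus partition: `R₀` for `false` and `R₁` for `true`. -/
abbrev baseRect (D : ℕ) (i : Bool) : Set V := rect (α D) (β D) i

/-- The footprint `R₀ ∪ R₁`. -/
def footprint (D : ℕ) : Set V := planeR₀ D ∪ planeR₁ D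

/-- The Markov crossing condition for the map `P ↦ ε P - c` from the rectangle `S` to the
rectangle `T`: it carries stable sides of `S` into stable sides of `T`, and its inverse carries
unstable sides of `T` into unstable sides of `S`. -/
structure IsCrossing {D : ℕ} (ε : (OK D)ˣ) (S T : Set V) (c : V) : Prop where
  mem_lattice : c ∈ lattice D
  stable : ∀ P ∈ S, ∀ Q ∈ T, (((unitPt D ε).1 * P.1 - c.1, Q.2) : V) ∈ T
  unstable : ∀ P ∈ S, ∀ Q ∈ T, ((P.1, (Q.2 + c.2) / (unitPt D ε).2) : V) ∈ S

/-- The part of a base rectangle mapped into a given translate of another one. -/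
def strip {D : ℕ} (ε : (OK D)ˣ) (i j : Bool) (c : V) : Set V :=
  baseRect D i ∩ (fun P => unitPt D ε * P - c) ⁻¹' baseRect D j

lemma mapsTo_Ioo_of_forall_ne {X Y : Type*} [TopologicalSpace X] [TopologicalSpace Y]
    [LinearOrder Y] [OrderClosedTopology Y] {f : X → Y} {s : Set X} {l r : Y}
    (hs : IsPreconnected s) (hf : ContinuousOn f s) {x₀ : X} (hx₀ : x₀ ∈ s)
    (hfx₀ : f x₀ ∈ Ioo l r) (hne : ∀ x ∈ s, ¬(f x = l ∨ f x = r)) : MapsTo f s (Ioo l r) := by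
  have hconn := (hs.image f hf).ordConnected
  intro x hx
  by_contra hcon
  rcases not_and_or.1 hcon with h | h
  · obtain ⟨z, hz, hfz⟩ := hconn.out (mem_image_of_mem f hx) (mem_image_of_mem f hx₀)
      ⟨not_lt.1 h, hfx₀.1.le⟩
    exact hne z hz (Or.inl hfz)
  · obtain ⟨z, hz, hfz⟩ := hconn.out (mem_image_of_mem f hx₀) (mem_image_of_mem f hx)
      ⟨hfx₀.2.le, not_lt.1 h⟩
    exact hne z hz (Or.inr hfz)

section Crossing

variable {D : ℕ} {ε : (OK D)ˣ} {i j k : Bool} {c c' : V}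

lemma unitPt_mul_sub_unstable (hu : 1 < (unitPt D ε).2) (x y : ℝ) (c : V) :
    unitPt D ε * (x, (y + c.2) / (unitPt D ε).2) - c = ((unitPt D ε).1 * x - c.1, y) := by
  have : (unitPt D ε).2 ≠ 0 := (zero_lt_one.trans hu).ne'
  ext
  · simp
  · simp only [Prod.snd_sub, Prod.snd_mul]
    field_simp
    ring

lemma unitPt_inv_mul_cancel_left (v : (OK D)ˣ) (P : V) : unitPt D v⁻¹ * (unitPt D v * P) = P := by
  rw [← mul_assoc, ← map_mul, inv_mul_cancel, map_one, one_mul]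

lemma fst_unitPt_mul_mem_stable_segment (hD : 1 < D) (hsq : Squarefree D)
    (hu : 1 < (unitPt D ε).2) {x : ℝ} (hx : x ∈ Icc (-1) (β D)) :
    (unitPt D ε).1 * x ∈ Icc (-1) (β D) := by
  have hlt := abs_lt.1 (abs_fst_unitPt_lt_one hu)
  obtain ⟨hx0, hx1⟩ := hx
  have hβ := β_pos hD
  rcases le_or_gt 0 (unitPt D ε).1 with h | h
  · constructor <;> nlinarith
  · have hle := α_le_snd_unitPt_of_fst_neg hD hsq hu h
    have hnorm : -(unitPt D ε).1 * (unitPt D ε).2 = 1 := by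
      rw [← abs_of_neg h, abs_fst_unitPt hu, inv_mul_cancel₀ (by linarith)]
    have hα : -(unitPt D ε).1 * α D ≤ 1 := by nlinarith
    have h1 : -(unitPt D ε).1 ≤ β D := by nlinarith [one_le_α_mul_β hD]
    have h2 : -(unitPt D ε).1 * β D ≤ 1 := by nlinarith [β_le_α hD]
    constructor <;> nlinarith

lemma mapsTo_stable_side (hD : 1 < D) (hsq : Squarefree D) (hu : 1 < (unitPt D ε).2) {P : V}
    (hc : c ∈ lattice D) (hP : P ∈ strip ε i j c) :
    MapsTo (fun x => (unitPt D ε).1 * x - c.1) (Ioo (rectLeft i) (rectRight (β D) i))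
      (Ioo (rectLeft j) (rectRight (β D) j)) := by
  have hα := zero_lt_one.trans (one_lt_α hD)
  have hβ := β_pos hD
  refine mapsTo_Ioo_of_forall_ne isPreconnected_Ioo (by fun_prop) hP.1.1 hP.2.1 fun x hx hside => ?_
  obtain ⟨w, hw, d, hd, he⟩ :=
    exists_eq_unstable_segment_add (b := β D) hα.le hside hP.2.2
  rw [← lattice_eq_grid hsq] at hd
  have himage : unitPt D ε * (x, P.2) = (0, w) + (d + c) := by
    rw [← add_assoc, ← he]
    ext <;> simp
  have hscale : ((0, w) : V) = unitPt D ε * (0, w / (unitPt D ε).2) := by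
    ext
    · simp
    · exact (mul_div_cancel₀ w (by linarith)).symm
  have hseg : ((x, P.2) : V) = (0, w / (unitPt D ε).2) + unitPt D ε⁻¹ * (d + c) := by
    rw [← unitPt_inv_mul_cancel_left ε (x, P.2), himage, mul_add, hscale,
      unitPt_inv_mul_cancel_left]
  have hw' : w / (unitPt D ε).2 ∈ Icc 0 (1 + α D) :=
    ⟨div_nonneg hw.1 (by linarith), (div_le_self hw.1 hu.le).trans hw.2⟩
  refine unstable_segment_add_notMem_rect hα.le hβ.le (i := i) hw' (lattice_eq_grid hsq ▸
    unitPt_mul_mem_lattice ε⁻¹ (add_mem hd hc)) ?_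
  rw [← hseg]
  exact ⟨hx, hP.1.2⟩

lemma mapsTo_unstable_side (hD : 1 < D) (hsq : Squarefree D) (hu : 1 < (unitPt D ε).2) {P : V}
    (hc : c ∈ lattice D) (hP : P ∈ strip ε i j c) :
    MapsTo (fun y => (y + c.2) / (unitPt D ε).2) (Ioo 0 (rectTop (α D) j))
      (Ioo 0 (rectTop (α D) i)) := by
  have hα := zero_lt_one.trans (one_lt_α hD)
  have hβ := β_pos hD
  have hP2 : ((unitPt D ε * P - c).2 + c.2) / (unitPt D ε).2 = P.2 := by
    have : (unitPt D ε).2 ≠ 0 := by linarith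
    simp only [Prod.snd_sub, Prod.snd_mul]
    field_simp
    ring
  refine mapsTo_Ioo_of_forall_ne isPreconnected_Ioo (by fun_prop) hP.2.2 (hP2.symm ▸ hP.1.2)
    fun y hy hside => ?_
  obtain ⟨x, hx, d, hd, he⟩ := exists_eq_stable_segment_add (a := α D) hβ.le hP.1.1 hside
  rw [← lattice_eq_grid hsq] at hd
  have hseg : (((unitPt D ε).1 * P.1 - c.1, y) : V) =
      ((unitPt D ε).1 * x, 0) + (unitPt D ε * d - c) := by
    rw [← unitPt_mul_sub_unstable hu, he, mul_add, add_sub_assoc]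
    congr 1
    ext <;> simp
  refine stable_segment_add_notMem_rect hα.le hβ.le (i := j)
    (fst_unitPt_mul_mem_stable_segment hD hsq hu hx)
    (lattice_eq_grid hsq ▸ sub_mem (unitPt_mul_mem_lattice ε hd) hc) ?_
  rw [← hseg]
  exact ⟨hP.2.1, hy⟩

lemma isCrossing_baseRect (hD : 1 < D) (hsq : Squarefree D) (hu : 1 < (unitPt D ε).2)
    (hc : c ∈ lattice D) (hne : (strip ε i j c).Nonempty) :
    IsCrossing ε (baseRect D i) (baseRect D j) c := by
  obtain ⟨P, hP⟩ := hne
  exact ⟨hc, fun A hA B hB => ⟨mapsTo_stable_side hD hsq hu hc hP hA.1, hB.2⟩,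
    fun A hA B hB => ⟨hA.1, mapsTo_unstable_side hD hsq hu hc hP hB.2⟩⟩

lemma isCrossing_strip (hD : 1 < D) (hsq : Squarefree D) (hu : 1 < (unitPt D ε).2)
    (hc : c ∈ lattice D) (hc' : c' ∈ lattice D) {P : V} (hP : P ∈ strip ε i j c)
    (hP' : unitPt D ε * P - c ∈ strip ε j k c') :
    IsCrossing ε (strip ε i j c) (strip ε j k c') c := by
  have h := isCrossing_baseRect hD hsq hu hc ⟨P, hP⟩
  refine ⟨hc, fun A hA B hB => ?_, fun A hA B hB => ⟨h.unstable A hA.1 B hB.1, ?_⟩⟩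
  · have hmem := h.stable A hA.1 B hB.1
    exact ⟨hmem, mapsTo_stable_side hD hsq hu hc' hP' hmem.1, hB.2.2⟩
  · rw [mem_preimage, unitPt_mul_sub_unstable hu]
    exact h.stable A hA.1 B hB.1

lemma nonempty_baseRect (hD : 1 < D) (i : Bool) : (baseRect D i).Nonempty := by
  have hα := zero_lt_one.trans (one_lt_α hD)
  have hβ := β_pos hD
  rw [baseRect, rect, prod_nonempty_iff, nonempty_Ioo, nonempty_Ioo]
  cases i <;> simp [rectLeft, rectRight, rectTop, hα, hβ]

lemma IsCrossing.snd_bounds (hD : 1 < D) (hu : 1 < (unitPt D ε).2)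
    (h : IsCrossing ε (baseRect D i) (baseRect D j) c) :
    0 ≤ c.2 ∧ c.2 + rectTop (α D) j ≤ (unitPt D ε).2 * rectTop (α D) i := by
  obtain ⟨P, hP⟩ := nonempty_baseRect hD i
  obtain ⟨Q, hQ⟩ := nonempty_baseRect hD j
  have hu0 : 0 < (unitPt D ε).2 := zero_lt_one.trans hu
  have hsub : Ioo c.2 (c.2 + rectTop (α D) j) ⊆ Ioo 0 ((unitPt D ε).2 * rectTop (α D) i) := by
    rintro y ⟨hy0, hy1⟩
    obtain ⟨-, h0, h1⟩ := h.unstable P hP (Q.1, y - c.2) ⟨hQ.1, by linarith, by linarith⟩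
    rw [sub_add_cancel] at h0 h1
    exact ⟨(div_pos_iff_of_pos_right hu0).1 h0, (div_lt_iff₀' hu0).1 h1⟩
  exact (Ioo_subset_Ioo_iff (by linarith [hQ.2.1, hQ.2.2])).1 hsub

lemma IsCrossing.eq_of_five {ε : (OK 5)ˣ} (hu : 1 < (unitPt 5 ε).2) (hle : (unitPt 5 ε).2 ≤ α 5)
    (h : IsCrossing ε (baseRect 5 i) (baseRect 5 j) c)
    (h' : IsCrossing ε (baseRect 5 i) (baseRect 5 j) c') : c = c' := by
  have hsq : Squarefree 5 := (by norm_num : Nat.Prime 5).squarefree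
  have hs : √(5 : ℝ) * √5 = 5 := Real.mul_self_sqrt (by norm_num)
  have h2 : 2 < √(5 : ℝ) := Real.lt_sqrt_of_sq_lt (by norm_num)
  have h3 : √(5 : ℝ) < 3 := (Real.sqrt_lt' (by norm_num)).2 (by norm_num)
  obtain ⟨P, hP⟩ := nonempty_baseRect (D := 5) (by norm_num) i
  obtain ⟨Q, hQ⟩ := nonempty_baseRect (D := 5) (by norm_num) j
  obtain ⟨hl, hr⟩ := (h.stable P hP Q hQ).1
  obtain ⟨hl', hr'⟩ := (h'.stable P hP Q hQ).1
  obtain ⟨hb, ht⟩ := h.snd_bounds (by norm_num) hu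
  obtain ⟨hb', ht'⟩ := h'.snd_bounds (by norm_num) hu
  have htop : (unitPt 5 ε).2 * rectTop (α 5) i ≤ (3 + √5) / 2 := by
    cases i <;> simp only [rectTop, α_five] at * <;> nlinarith
  have habs : |c.1 - c'.1| < 1 ∧ |c.1 - c'.1| + |c.2 - c'.2| < α 5 + β 5 := by
    rw [α_five, β_five] at *
    have h2abs : |c.2 - c'.2| ≤ (3 + √5) / 2 - rectTop ((1 + √5) / 2) j :=
      abs_le.2 ⟨by linarith, by linarith⟩
    cases j <;> simp only [rectLeft, rectRight, rectTop] at *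
    · have h1abs : |c.1 - c'.1| < (√5 - 1) / 2 := abs_lt.2 ⟨by linarith, by linarith⟩
      constructor <;> linarith
    · have h1abs : |c.1 - c'.1| < 1 := abs_lt.2 ⟨by linarith, by linarith⟩
      constructor <;> linarith
  refine sub_eq_zero.1 (eq_zero_of_mem_grid (a := α 5) (b := β 5) ?_ (β_pos (by norm_num))
    (lattice_eq_grid hsq ▸ sub_mem h.mem_lattice h'.mem_lattice) habs.1 habs.2)
  exact (zero_lt_one.trans (one_lt_α (by norm_num))).le

end Crossing

/-! ### The letters and their transitions -/

section Letters

variable {D : ℕ} {ε : (OK D)ˣ} {i j : Bool} {c : V}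

lemma proj_eq_proj {P Q : V} : proj D P = proj D Q ↔ Q - P ∈ lattice D := by
  rw [proj, proj, QuotientAddGroup.eq, neg_add_eq_sub]

lemma proj_sub {P : V} (hc : c ∈ lattice D) : proj D (P - c) = proj D P := by
  rw [proj_eq_proj, sub_sub_cancel]
  exact hc

lemma exists_proj_eq (p : Torus D) : ∃ P, proj D P = p :=
  QuotientAddGroup.mk_surjective p

lemma continuous_proj (D : ℕ) : Continuous (proj D) := continuous_quotient_mk'

lemma isOpenMap_proj (D : ℕ) : IsOpenMap (proj D) := QuotientAddGroup.isOpenMap_coe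

lemma phi_proj (ε : (OK D)ˣ) (P : V) : phi D ε (proj D P) = proj D (unitPt D ε * P) := rfl

lemma baseRect_subset_footprint (D : ℕ) (i : Bool) : baseRect D i ⊆ footprint D := by
  cases i
  exacts [subset_union_left, subset_union_right]

lemma strip_subset_footprint (ε : (OK D)ˣ) (i j : Bool) (c : V) : strip ε i j c ⊆ footprint D :=
  inter_subset_left.trans (baseRect_subset_footprint D i)

lemma baseRect_translate_unique (hD : 1 < D) (hsq : Squarefree D) {P Q : V}
    (h : Q - P ∈ lattice D) (hP : P ∈ baseRect D i) (hQ : Q ∈ baseRect D j) : i = j ∧ P = Q :=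
  rect_translate_unique (zero_lt_one.trans (one_lt_α hD)).le (β_pos hD).le
    (lattice_eq_grid hsq ▸ h) hP hQ

lemma injOn_proj_footprint (hD : 1 < D) (hsq : Squarefree D) :
    InjOn (proj D) (footprint D) := by
  have exists_mem_baseRect {P : V} (hP : P ∈ footprint D) : ∃ i, P ∈ baseRect D i :=
    hP.elim (fun h => ⟨false, h⟩) fun h => ⟨true, h⟩
  intro P hP Q hQ h
  obtain ⟨i, hi⟩ := exists_mem_baseRect hP
  obtain ⟨j, hj⟩ := exists_mem_baseRect hQ
  exact (baseRect_translate_unique hD hsq (proj_eq_proj.1 h) hi hj).2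

lemma planeRep_image_proj (hD : 1 < D) (hsq : Squarefree D) {S : Set V} (hS : S ⊆ footprint D) :
    planeRep D (proj D '' S) = S :=
  (injOn_proj_footprint hD hsq).preimage_image_inter hS

lemma twoRect_eq_range (D : ℕ) : twoRect D = range fun i => proj D '' baseRect D i := by
  ext A
  simp only [mem_range, Bool.exists_bool, eq_comm (b := A)]
  rfl

lemma isOpen_baseRect (D : ℕ) (i : Bool) : IsOpen (baseRect D i) := isOpen_Ioo.prod isOpen_Ioo

lemma isOpen_strip (ε : (OK D)ˣ) (i j : Bool) (c : V) : IsOpen (strip ε i j c) :=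
  (isOpen_baseRect D i).inter ((isOpen_baseRect D j).preimage (by fun_prop))

lemma convex_baseRect (D : ℕ) (i : Bool) : Convex ℝ (baseRect D i) :=
  (convex_Ioo _ _).prod (convex_Ioo _ _)

lemma convex_strip (ε : (OK D)ˣ) (i j : Bool) (c : V) : Convex ℝ (strip ε i j c) := by
  simp_rw [strip, sub_eq_add_neg]
  exact (convex_baseRect D i).inter
    (((convex_baseRect D j).translate_preimage_left (-c)).is_linear_preimage
      (LinearMap.mulLeft ℝ (unitPt D ε)).isLinear)

lemma connectedComponentIn_iUnion_eq {X ι : Type*} [TopologicalSpace X] {u : ι → Set X}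
    (ho : ∀ i, IsOpen (u i)) {i : ι} (hc : IsPreconnected (u i))
    (hd : ∀ j, (u i ∩ u j).Nonempty → u j = u i) {x : X} (hx : x ∈ u i) :
    connectedComponentIn (⋃ j, u j) x = u i := by
  have hi : u i ⊆ ⋃ j, u j := subset_iUnion u i
  refine Subset.antisymm ?_ (hc.subset_connectedComponentIn hx hi)
  refine isPreconnected_connectedComponentIn.subset_left_of_subset_union (ho i)
    (isOpen_iUnion fun j : {j // u j ≠ u i} => ho j) ?_ ?_ ⟨x, mem_connectedComponentIn (hi hx), hx⟩
  · rw [disjoint_iUnion_right]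
    rintro ⟨j, hj⟩
    rw [disjoint_iff_inter_eq_empty, ← not_nonempty_iff_eq_empty]
    exact fun h => hj (hd j h)
  · refine (connectedComponentIn_subset _ x).trans (iUnion_subset fun j => ?_)
    by_cases h : u j = u i
    · exact h ▸ subset_union_left
    · exact (subset_iUnion (fun j : {j // u j ≠ u i} => u j) ⟨j, h⟩).trans subset_union_right

lemma inter_phi_preimage_eq_iUnion_strip (ε : (OK D)ˣ) (i j : Bool) :
    proj D '' baseRect D i ∩ phi D ε ⁻¹' (proj D '' baseRect D j) =
      ⋃ c : lattice D, proj D '' strip ε i j c := by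
  ext p
  simp only [mem_inter_iff, mem_preimage, mem_iUnion]
  constructor
  · rintro ⟨⟨P, hP, rfl⟩, Q, hQ, hQP⟩
    rw [phi_proj, proj_eq_proj] at hQP
    exact ⟨⟨_, hQP⟩, P, ⟨hP, by simpa using hQ⟩, rfl⟩
  · rintro ⟨⟨c, hc⟩, P, hP, rfl⟩
    exact ⟨⟨P, hP.1, rfl⟩, _, hP.2, by rw [proj_sub hc, phi_proj]⟩

lemma exists_connectedComponentIn_eq_strip (hD : 1 < D) (hsq : Squarefree D) (ε : (OK D)ˣ)
    {x : Torus D} (hx : x ∈ proj D '' baseRect D i ∩ phi D ε ⁻¹' (proj D '' baseRect D j)) :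
    ∃ c ∈ lattice D,
      connectedComponentIn (proj D '' baseRect D i ∩ phi D ε ⁻¹' (proj D '' baseRect D j)) x =
        proj D '' strip ε i j c := by
  rw [inter_phi_preimage_eq_iUnion_strip] at hx ⊢
  obtain ⟨c, hxc⟩ := mem_iUnion.1 hx
  refine ⟨c, c.2, connectedComponentIn_iUnion_eq
    (u := fun c : lattice D => proj D '' strip ε i j c)
    (fun c => isOpenMap_proj D _ (isOpen_strip ε i j c))
    ((convex_strip ε i j c).isPreconnected.image _ (continuous_proj D).continuousOn) ?_ hxc⟩
  rintro d ⟨_, ⟨P, hP, rfl⟩, Q, hQ, hQP⟩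
  obtain rfl := injOn_proj_footprint hD hsq (strip_subset_footprint ε i j d hQ)
    (strip_subset_footprint ε i j c hP) hQP
  have htranslate : (unitPt D ε * Q - d) - (unitPt D ε * Q - c) ∈ lattice D := by
    rw [sub_sub_sub_cancel_left]
    exact sub_mem c.2 d.2
  have h := (baseRect_translate_unique hD hsq htranslate hP.2 hQ.2).2
  rw [sub_right_inj] at h
  rw [h]

lemma exists_letter_eq_baseRect (h5 : D = 5) (A : Letter D ε) :
    ∃ i, (A : Set (Torus D)) = proj D '' baseRect D i := by
  obtain ⟨A, hA⟩ := A
  unfold P₀ at hA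
  rw [if_pos h5, twoRect_eq_range] at hA
  exact hA.imp fun _ => Eq.symm

lemma exists_letter_eq_strip (hD : 1 < D) (hsq : Squarefree D) (h5 : D ≠ 5) (A : Letter D ε) :
    ∃ i j, ∃ c ∈ lattice D, (A : Set (Torus D)) = proj D '' strip ε i j c := by
  obtain ⟨A, hA⟩ := A
  unfold P₀ at hA
  rw [if_neg h5, twoRect_eq_range] at hA
  obtain ⟨_, ⟨i, rfl⟩, _, ⟨j, rfl⟩, x, hx, hA⟩ := hA
  obtain ⟨c, hc, he⟩ := exists_connectedComponentIn_eq_strip hD hsq ε hx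
  exact ⟨i, j, c, hc, hA.trans he⟩

lemma image_proj_planeRep_letter (hD : 1 < D) (hsq : Squarefree D) (A : Letter D ε) :
    proj D '' planeRep D A = A := by
  obtain ⟨S, hS, hA⟩ : ∃ S ⊆ footprint D, (A : Set (Torus D)) = proj D '' S := by
    by_cases h5 : D = 5
    · obtain ⟨i, hA⟩ := exists_letter_eq_baseRect h5 A
      exact ⟨_, baseRect_subset_footprint D i, hA⟩
    · obtain ⟨i, j, c, -, hA⟩ := exists_letter_eq_strip hD hsq h5 A
      exact ⟨_, strip_subset_footprint ε i j c, hA⟩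
  rw [hA, planeRep_image_proj hD hsq hS]

/-- A crossing `P ↦ ε P - c` from `S` to `T` is a transition if it computes `φ` in planar
representatives, wherever `φ` maps `S` into `T`. -/
structure IsTransition (ε : (OK D)ˣ) (S T : Set V) (c : V) : Prop extends IsCrossing ε S T c where
  lift : ∀ P ∈ S, phi D ε (proj D P) ∈ proj D '' T → unitPt D ε * P - c ∈ T

lemma exists_sub_mem_of_phi_proj_mem {T : Set V} {P : V}
    (h : phi D ε (proj D P) ∈ proj D '' T) : ∃ c ∈ lattice D, unitPt D ε * P - c ∈ T := by
  obtain ⟨Q, hQ, hQP⟩ := h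
  rw [phi_proj, proj_eq_proj] at hQP
  exact ⟨_, hQP, by rwa [sub_sub_cancel]⟩

lemma exists_isTransition_baseRect_five {ε : (OK 5)ˣ} (hu : 1 < (unitPt 5 ε).2)
    (hle : (unitPt 5 ε).2 ≤ α 5) {P : V} (hP : P ∈ baseRect 5 i)
    (hφ : phi 5 ε (proj 5 P) ∈ proj 5 '' baseRect 5 j) :
    ∃ c, IsTransition ε (baseRect 5 i) (baseRect 5 j) c := by
  have hsq : Squarefree 5 := (by norm_num : Nat.Prime 5).squarefree
  have crossing {c P : V} (hc : c ∈ lattice 5) (hP : P ∈ strip ε i j c) :=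
    isCrossing_baseRect (by norm_num) hsq hu hc ⟨P, hP⟩
  obtain ⟨c, hc, hcT⟩ := exists_sub_mem_of_phi_proj_mem hφ
  have h := crossing hc ⟨hP, hcT⟩
  refine ⟨c, h, fun Q hQ hφQ => ?_⟩
  obtain ⟨d, hd, hdT⟩ := exists_sub_mem_of_phi_proj_mem hφQ
  rwa [h.eq_of_five hu hle (crossing hd ⟨hQ, hdT⟩)]

lemma exists_isTransition_strip (hD : 1 < D) (hsq : Squarefree D) (hu : 1 < (unitPt D ε).2)
    {i' j' : Bool} {c' : V} (hc : c ∈ lattice D) (hc' : c' ∈ lattice D) {P : V}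
    (hP : P ∈ strip ε i j c) (hφ : phi D ε (proj D P) ∈ proj D '' strip ε i' j' c') :
    ∃ d, IsTransition ε (strip ε i j c) (strip ε i' j' c') d := by
  have lift : ∀ Q ∈ strip ε i j c, phi D ε (proj D Q) ∈ proj D '' strip ε i' j' c' →
      unitPt D ε * Q - c ∈ strip ε i' j' c' := by
    rintro Q hQ ⟨R, hR, hRQ⟩
    rw [phi_proj] at hRQ
    have hR' : R = unitPt D ε * Q - c :=
      injOn_proj_footprint hD hsq (strip_subset_footprint ε i' j' c' hR)
        (baseRect_subset_footprint D j hQ.2) (hRQ.trans (proj_sub hc).symm)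
    exact hR' ▸ hR
  have hP' := lift P hP hφ
  obtain ⟨rfl, -⟩ := baseRect_translate_unique hD hsq (by simp [zero_mem]) hP.2 hP'.1
  exact ⟨c, isCrossing_strip hD hsq hu hc hc' hP hP', lift⟩

lemma exists_isTransition_planeRep (hD : 1 < D) (hsq : Squarefree D) (hu : 1 < (unitPt D ε).2)
    (h5 : D = 5 → (unitPt D ε).2 ≤ α D) (A B : Letter D ε)
    (h : ((A : Set (Torus D)) ∩ phi D ε ⁻¹' (B : Set (Torus D))).Nonempty) :
    ∃ c, IsTransition ε (planeRep D A) (planeRep D B) c := by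
  obtain ⟨_, hA, hB⟩ := h
  by_cases h5' : D = 5
  · subst h5'
    obtain ⟨i, hAi⟩ := exists_letter_eq_baseRect rfl A
    obtain ⟨j, hBj⟩ := exists_letter_eq_baseRect rfl B
    rw [hAi] at hA
    rw [hBj] at hB
    obtain ⟨P, hP, rfl⟩ := hA
    rw [hAi, hBj, planeRep_image_proj hD hsq (baseRect_subset_footprint 5 i),
      planeRep_image_proj hD hsq (baseRect_subset_footprint 5 j)]
    exact exists_isTransition_baseRect_five hu (h5 rfl) hP hB
  · obtain ⟨i, j, c, hc, hAc⟩ := exists_letter_eq_strip hD hsq h5' A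
    obtain ⟨i', j', c', hc', hBc⟩ := exists_letter_eq_strip hD hsq h5' B
    rw [hAc] at hA
    rw [hBc] at hB
    obtain ⟨P, hP, rfl⟩ := hA
    rw [hAc, hBc, planeRep_image_proj hD hsq (strip_subset_footprint ε i j c),
      planeRep_image_proj hD hsq (strip_subset_footprint ε i' j' c')]
    exact exists_isTransition_strip hD hsq hu hc hc' hP hB

end Letters

/-! ### Iterates of the automorphism -/

section Orbits

variable {D : ℕ} {ε : (OK D)ˣ}

lemma phi_mul (v w : (OK D)ˣ) : phi D (v * w) = phi D v * phi D w := by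
  ext p
  obtain ⟨P, rfl⟩ := exists_proj_eq p
  rw [Equiv.Perm.mul_apply, phi_proj, phi_proj, phi_proj, map_mul, mul_assoc]

lemma phi_zpow (ε : (OK D)ˣ) (k : ℤ) : phi D ε ^ k = phi D (ε ^ k) :=
  (map_zpow (MonoidHom.mk' (phi D) phi_mul) ε k).symm

lemma continuous_phi (v : (OK D)ˣ) : Continuous (phi D v) :=
  (QuotientAddGroup.isQuotientMap_mk (N := lattice D)).continuous_iff.2
    ((continuous_proj D).comp (continuous_const_mul (unitPt D v)))

lemma discreteTopology_lattice (hD : 1 < D) (hsq : Squarefree D) :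
    DiscreteTopology (lattice D) := by
  have hα := one_lt_α hD
  have hβ := β_pos hD
  refine discreteTopology_of_isOpen_singleton_zero (Metric.isOpen_singleton_iff.2
    ⟨1 / 2, by norm_num, fun c hc => Subtype.ext ?_⟩)
  have hnorm : ‖(c : V)‖ < 1 / 2 := by simpa using hc
  have h1 : |(c : V).1| < 1 / 2 := (norm_fst_le (c : V)).trans_lt hnorm
  have h2 : |(c : V).2| < 1 / 2 := (norm_snd_le (c : V)).trans_lt hnorm
  exact eq_zero_of_mem_grid (a := α D) (by linarith) hβ (lattice_eq_grid hsq ▸ c.2)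
    (by linarith) (by linarith)

lemma isClosed_lattice (hD : 1 < D) (hsq : Squarefree D) : IsClosed (lattice D : Set V) := by
  have := discreteTopology_lattice hD hsq
  exact AddSubgroup.isClosed_of_discrete

lemma t2Space_torus (hD : 1 < D) (hsq : Squarefree D) : T2Space (Torus D) := by
  have := isClosed_lattice hD hsq
  infer_instance

lemma exists_forall_phi_pow_mem (hu : 1 < (unitPt D ε).2) {S : ℕ → Set V} {c : ℕ → V}
    (hS : ∀ i, (S i).Nonempty) (hc : ∀ i, IsCrossing ε (S i) (S (i + 1)) (c i)) (n : ℕ) {A : V}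
    (hA : A ∈ S 0) :
    ∃ P ∈ S 0, P.1 = A.1 ∧ ∀ i ≤ n, (phi D ε ^ i) (proj D P) ∈ proj D '' S i := by
  induction n generalizing S c A with
  | zero =>
    refine ⟨A, hA, rfl, fun i hi => ?_⟩
    obtain rfl := Nat.le_zero.1 hi
    exact ⟨A, hA, rfl⟩
  | succ n ih =>
    obtain ⟨B, hB⟩ := hS 1
    obtain ⟨Q, hQ, hQ1, hQn⟩ := ih (fun i => hS (i + 1)) (fun i => hc (i + 1))
      ((hc 0).stable A hA B hB)
    dsimp only at hQ1
    have hP := (hc 0).unstable A hA Q hQ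
    refine ⟨_, hP, rfl, fun i hi => ?_⟩
    cases i with
    | zero => exact ⟨_, hP, rfl⟩
    | succ i =>
      have hstep : phi D ε (proj D (A.1, (Q.2 + (c 0).2) / (unitPt D ε).2)) = proj D Q := by
        rw [phi_proj, ← proj_sub (hc 0).mem_lattice, unitPt_mul_sub_unstable hu, ← hQ1]
      rw [pow_succ, Equiv.Perm.mul_apply, hstep]
      exact hQn i (by omega)

end Orbits

/-! ### Cylinders -/

section Cylinders

variable {D : ℕ} {ε : (OK D)ˣ} {s : ℤ → Letter D ε} {n : ℕ}

lemma exists_isTransition_of_mem_sigma (hD : 1 < D) (hsq : Squarefree D)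
    (hu : 1 < (unitPt D ε).2) (h5 : D = 5 → (unitPt D ε).2 ≤ α D) (hs : s ∈ Sigma D ε) :
    ∃ c : ℤ → V, ∀ i, IsTransition ε (planeRep D (s i)) (planeRep D (s (i + 1))) (c i) :=
  Classical.axiom_of_choice fun i => exists_isTransition_planeRep hD hsq hu h5 _ _ (hs i)

lemma nonempty_planeRep_of_mem_sigma (hD : 1 < D) (hsq : Squarefree D) (hs : s ∈ Sigma D ε)
    (i : ℤ) : (planeRep D (s i)).Nonempty := by
  rw [← image_nonempty, image_proj_planeRep_letter hD hsq]
  exact (hs i).left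

/-- The planar representative of the central cylinder `[s_{-n} ⋯ s_n]` of a string `s`. -/
def cylinder (s : ℤ → Letter D ε) (n : ℕ) : Set V := planeRep D (wordSet (window s 0 n))

lemma mem_wordSet_window_zero {p : Torus D} : p ∈ wordSet (window s 0 n) ↔
    ∀ i : ℤ, |i| ≤ n → (phi D ε ^ i) p ∈ (s i : Set (Torus D)) := by
  simp [wordSet, window, abs_le]

lemma wordSet_window_zero_subset : wordSet (window s 0 n) ⊆ s 0 := fun _ hp => by
  simpa using mem_wordSet_window_zero.1 hp 0 (by simp)

lemma image_proj_cylinder (hD : 1 < D) (hsq : Squarefree D) :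
    proj D '' cylinder s n = wordSet (window s 0 n) := by
  rw [cylinder, planeRep, image_preimage_inter, inter_eq_left]
  refine wordSet_window_zero_subset.trans ?_
  rw [← image_proj_planeRep_letter hD hsq (s 0)]
  exact image_mono inter_subset_right

lemma nonempty_cylinder (hD : 1 < D) (hsq : Squarefree D) (hu : 1 < (unitPt D ε).2)
    (h5 : D = 5 → (unitPt D ε).2 ≤ α D) (hs : s ∈ Sigma D ε) (n : ℕ) :
    (cylinder s n).Nonempty := by
  obtain ⟨c, hc⟩ := exists_isTransition_of_mem_sigma hD hsq hu h5 hs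
  have hne := nonempty_planeRep_of_mem_sigma hD hsq hs
  obtain ⟨P, -, -, hP⟩ := exists_forall_phi_pow_mem hu
    (S := fun i => planeRep D (s (-n + i))) (c := fun i => c (-n + i)) (fun i => hne _)
    (fun i => by simpa [add_assoc] using (hc (-n + i)).toIsCrossing) (2 * n) (hne _).some_mem
  rw [← image_nonempty, image_proj_cylinder hD hsq]
  refine ⟨(phi D ε ^ n) (proj D P), mem_wordSet_window_zero.2 fun i hi => ?_⟩
  rw [abs_le] at hi
  obtain ⟨m, hm⟩ := Int.eq_ofNat_of_zero_le (by omega : 0 ≤ n + i)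
  have hPm := hP m (by omega)
  rwa [image_proj_planeRep_letter hD hsq, ← hm, neg_add_cancel_left, ← zpow_natCast, ← hm,
    add_comm, zpow_add, Equiv.Perm.mul_apply, zpow_natCast (phi D ε) n] at hPm

lemma IsTransition.eq_of_proj_eq (hD : 1 < D) (hsq : Squarefree D) {A B : Letter D ε} {c P Q : V}
    (h : IsTransition ε (planeRep D A) (planeRep D B) c) (hP : P ∈ planeRep D A)
    (hQ : Q ∈ planeRep D B) (hPQ : proj D Q = phi D ε (proj D P)) : Q = unitPt D ε * P - c := by
  have hlift := h.lift P hP (hPQ ▸ mem_image_of_mem _ hQ)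
  refine injOn_proj_footprint hD hsq hQ.2 hlift.2 ?_
  rw [proj_sub h.mem_lattice, hPQ, phi_proj]

lemma exists_orbit_of_mem_cylinder (hD : 1 < D) (hsq : Squarefree D) {c : ℤ → V}
    (hc : ∀ i, IsTransition ε (planeRep D (s i)) (planeRep D (s (i + 1))) (c i)) {P : V}
    (hP : P ∈ cylinder s n) :
    ∃ R : ℤ → V, R 0 = P ∧ (∀ i : ℤ, |i| ≤ n → R i ∈ footprint D) ∧
      ∀ i : ℤ, |i| ≤ n → |i + 1| ≤ n → R (i + 1) = unitPt D ε * R i - c i := by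
  have hlift : ∀ i : ℤ, ∃ Q, |i| ≤ n →
      Q ∈ planeRep D (s i) ∧ proj D Q = (phi D ε ^ i) (proj D P) := fun i => by
    by_cases hi : |i| ≤ n
    · have hPi := mem_wordSet_window_zero.1 hP.1 i hi
      rw [← image_proj_planeRep_letter hD hsq] at hPi
      exact hPi.imp fun _ h _ => h
    · exact ⟨0, fun h => absurd h hi⟩
  choose R hR using hlift
  refine ⟨R, ?_, fun i hi => (hR i hi).1.2, fun i hi hi' => ?_⟩
  · obtain ⟨hR0, hR0P⟩ := hR 0 (by simp)
    exact injOn_proj_footprint hD hsq hR0.2 hP.2 (by simpa using hR0P)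
  · refine (hc i).eq_of_proj_eq hD hsq (hR i hi).1 (hR _ hi').1 ?_
    rw [(hR _ hi').2, (hR i hi).2, add_comm, zpow_one_add, Equiv.Perm.mul_apply]

lemma sub_eq_pow_mul_sub {v : V} {N : ℤ} {R S c : ℤ → V}
    (hR : ∀ i, |i| ≤ N → |i + 1| ≤ N → R (i + 1) = v * R i - c i)
    (hS : ∀ i, |i| ≤ N → |i + 1| ≤ N → S (i + 1) = v * S i - c i) (k : ℤ) (m : ℕ)
    (hk : -N ≤ k) (hm : k + m ≤ N) : R (k + m) - S (k + m) = v ^ m * (R k - S k) := by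
  induction m with
  | zero => simp
  | succ m ih =>
    push_cast at hm ⊢
    have hi : |k + m| ≤ N := abs_le.2 ⟨by omega, by omega⟩
    have hi' : |k + m + 1| ≤ N := abs_le.2 ⟨by omega, by omega⟩
    rw [← add_assoc, hR _ hi hi', hS _ hi hi', sub_sub_sub_cancel_right, ← mul_sub,
      ih (by omega), pow_succ', mul_assoc]

lemma isBounded_footprint (D : ℕ) : Bornology.IsBounded (footprint D) :=
  ((Metric.isBounded_Ioo _ _).prod (Metric.isBounded_Ioo _ _)).union
    ((Metric.isBounded_Ioo _ _).prod (Metric.isBounded_Ioo _ _))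

lemma diam_cylinder_le (hD : 1 < D) (hsq : Squarefree D) (hu : 1 < (unitPt D ε).2)
    (h5 : D = 5 → (unitPt D ε).2 ≤ α D) (hs : s ∈ Sigma D ε) (n : ℕ) :
    Metric.diam (cylinder s n) ≤ Metric.diam (footprint D) * (unitPt D ε).2⁻¹ ^ n := by
  obtain ⟨c, hc⟩ := exists_isTransition_of_mem_sigma hD hsq hu h5 hs
  refine Metric.diam_le_of_forall_dist_le (by positivity) fun P hP Q hQ => ?_
  obtain ⟨R, rfl, hR, hstepR⟩ := exists_orbit_of_mem_cylinder hD hsq hc hP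
  obtain ⟨S, rfl, hS, hstepS⟩ := exists_orbit_of_mem_cylinder hD hsq hc hQ
  have hdist {i : ℤ} (hi : |i| ≤ n) : ‖R i - S i‖ ≤ Metric.diam (footprint D) := by
    rw [← dist_eq_norm]
    exact Metric.dist_le_diam_of_mem (isBounded_footprint D) (hR i hi) (hS i hi)
  have hforward : R n - S n = unitPt D ε ^ n * (R 0 - S 0) := by
    simpa using sub_eq_pow_mul_sub hstepR hstepS 0 n
  have hbackward : R 0 - S 0 = unitPt D ε ^ n * (R (-n) - S (-n)) := by
    simpa using sub_eq_pow_mul_sub hstepR hstepS (-n) n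
  rw [dist_eq_norm, norm_prod_le_iff, inv_pow]
  constructor
  · rw [hbackward, Prod.fst_mul, Prod.pow_fst, norm_mul, norm_pow, Real.norm_eq_abs,
      abs_fst_unitPt hu, inv_pow, mul_comm]
    gcongr
    exact (norm_fst_le _).trans (hdist (by simp))
  · rw [← div_eq_mul_inv, le_div_iff₀ (by positivity), mul_comm]
    calc (unitPt D ε).2 ^ n * ‖(R 0 - S 0).2‖ = ‖(R n - S n).2‖ := by
          rw [hforward, Prod.snd_mul, Prod.pow_snd, norm_mul, norm_pow,
            Real.norm_of_nonneg (zero_lt_one.trans hu).le]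
      _ ≤ _ := (norm_snd_le _).trans (hdist (by simp))

end Cylinders

/-! ### The coding map -/

lemma exists_iInter_image_eq_singleton {X Y : Type*} [MetricSpace X] [TopologicalSpace Y]
    {f : X → Y} {K : ℕ → Set X} (hanti : Antitone K) (hne : ∀ n, (K n).Nonempty)
    (hK : ∀ n, IsCompact (K n)) (hdiam : Tendsto (fun n => Metric.diam (K n)) atTop (𝓝 0))
    [T2Space Y] (hf : Continuous f) : ∃ x, (∀ n, x ∈ K n) ∧ ⋂ n, f '' K n = {f x} := by
  obtain ⟨x, hx⟩ := IsCompact.nonempty_iInter_of_sequence_nonempty_isCompact_isClosed K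
    (fun n => hanti n.le_succ) hne (hK 0) fun n => (hK n).isClosed
  rw [mem_iInter] at hx
  refine ⟨x, hx, Subset.antisymm (fun y hy => ?_) ?_⟩
  · choose z hz hzy using mem_iInter.1 hy
    have hzx : Tendsto z atTop (𝓝 x) := by
      rw [tendsto_iff_dist_tendsto_zero]
      exact squeeze_zero (fun _ => dist_nonneg)
        (fun n => Metric.dist_le_diam_of_mem (hK n).isBounded (hz n) (hx n)) hdiam
    have hfz : Tendsto (fun n => f (z n)) atTop (𝓝 (f x)) := (hf.tendsto x).comp hzx
    simp_rw [hzy] at hfz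
    exact tendsto_nhds_unique tendsto_const_nhds hfz
  · exact singleton_subset_iff.2 (mem_iInter.2 fun n => mem_image_of_mem f (hx n))

section Coding

variable {D : ℕ} {ε : (OK D)ˣ} {s : ℤ → Letter D ε} {p q : Torus D}

lemma isCompact_closure_cylinder (s : ℤ → Letter D ε) (n : ℕ) :
    IsCompact (closure (cylinder s n)) :=
  ((isBounded_footprint D).subset inter_subset_right).isCompact_closure

lemma antitone_cylinder (s : ℤ → Letter D ε) : Antitone (cylinder s) := fun _ _ hmn _ hP =>
  ⟨mem_wordSet_window_zero.2 fun i hi =>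
    mem_wordSet_window_zero.1 hP.1 i (hi.trans (Int.ofNat_le.2 hmn)), hP.2⟩

lemma image_proj_closure_cylinder (hD : 1 < D) (hsq : Squarefree D) (n : ℕ) :
    proj D '' closure (cylinder s n) = closure (wordSet (window s 0 n)) := by
  have := t2Space_torus hD hsq
  rw [← image_proj_cylinder hD hsq,
    image_closure_of_isCompact (isCompact_closure_cylinder s n) (continuous_proj D).continuousOn]

lemma tendsto_diam_footprint_mul_pow (hu : 1 < (unitPt D ε).2) :
    Tendsto (fun n : ℕ => Metric.diam (footprint D) * (unitPt D ε).2⁻¹ ^ n) atTop (𝓝 0) := by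
  simpa using (tendsto_pow_atTop_nhds_zero_of_lt_one (inv_nonneg.2 (zero_lt_one.trans hu).le)
    (inv_lt_one_of_one_lt₀ hu)).const_mul (Metric.diam (footprint D))

lemma exists_isCoded_proj (hD : 1 < D) (hsq : Squarefree D) (hu : 1 < (unitPt D ε).2)
    (h5 : D = 5 → (unitPt D ε).2 ≤ α D) (hs : s ∈ Sigma D ε) :
    ∃ P, (∀ n, P ∈ closure (cylinder s n)) ∧ IsCoded s (proj D P) := by
  have := t2Space_torus hD hsq
  simp only [IsCoded, ← image_proj_closure_cylinder hD hsq]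
  refine exists_iInter_image_eq_singleton (fun _ _ h => closure_mono (antitone_cylinder s h))
    (fun n => (nonempty_cylinder hD hsq hu h5 hs n).closure) (isCompact_closure_cylinder s)
    (squeeze_zero (fun _ => Metric.diam_nonneg) (fun n => ?_)
      (tendsto_diam_footprint_mul_pow hu)) (continuous_proj D)
  rw [Metric.diam_closure]
  exact diam_cylinder_le hD hsq hu h5 hs n

lemma IsCoded.unique (hp : IsCoded s p) (hq : IsCoded s q) : p = q :=
  singleton_injective (hp.symm.trans hq)

lemma IsCoded.mem_closure (hp : IsCoded s p) (n : ℕ) : p ∈ closure (wordSet (window s 0 n)) :=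
  mem_iInter.1 (hp.symm ▸ mem_singleton p : p ∈ ⋂ n, closure (wordSet (window s 0 n))) n

/-- The `k`-th iterate of the shift map on bi-infinite strings, so that words of `s` centred at `k`
become words of `shift k s` centred at `0`. -/
def shift (k : ℤ) (s : ℤ → Letter D ε) : ℤ → Letter D ε := fun i => s (k + i)

lemma shift_mem_sigma (hs : s ∈ Sigma D ε) (k : ℤ) : shift k s ∈ Sigma D ε := fun i => by
  simpa only [shift, add_assoc] using hs (k + i)

lemma window_shift_zero (s : ℤ → Letter D ε) (k : ℤ) (n : ℕ) :
    window (shift k s) 0 n = window s k n := by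
  ext1 i
  simp only [window, shift, zero_add]

lemma mapsTo_phi_zpow_wordSet (s : ℤ → Letter D ε) (k : ℤ) (n : ℕ) :
    MapsTo (phi D ε ^ k) (wordSet (window s 0 (n + k.natAbs)))
      (wordSet (window (shift k s) 0 n)) := fun p hp =>
  mem_wordSet_window_zero.2 fun i hi => by
    rw [← Equiv.Perm.mul_apply, ← zpow_add, add_comm]
    refine mem_wordSet_window_zero.1 hp (k + i) ((abs_add_le k i).trans ?_)
    push_cast
    linarith

lemma IsCoded.exists_planar_iterate (hD : 1 < D) (hsq : Squarefree D) (hu : 1 < (unitPt D ε).2)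
    (h5 : D = 5 → (unitPt D ε).2 ≤ α D) (hs : s ∈ Sigma D ε) (hp : IsCoded s p) (k : ℤ) :
    ∃ P, proj D P = (phi D ε ^ k) p ∧ ∀ n, P ∈ closure (cylinder (shift k s) n) := by
  obtain ⟨P, hP, hcoded⟩ := exists_isCoded_proj hD hsq hu h5 (shift_mem_sigma hs k)
  have hcont : Continuous (phi D ε ^ k) := phi_zpow ε k ▸ continuous_phi (ε ^ k)
  have hpk : (phi D ε ^ k) p ∈ ⋂ n, closure (wordSet (window (shift k s) 0 n)) :=
    mem_iInter.2 fun n =>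
      map_mem_closure hcont (hp.mem_closure _) (mapsTo_phi_zpow_wordSet s k n)
  exact ⟨P, (Eq.subset hcoded hpk).symm, hP⟩

end Coding

/-! ### The Euclidean minimum and bounded witnesses -/

section Minimum

variable {D : ℕ} {ε : (OK D)ˣ}

lemma absNorm_le_norm_sq (P : V) : absNorm P ≤ ‖P‖ ^ 2 := by
  rw [absNorm, abs_mul, sq]
  exact mul_le_mul (norm_fst_le P) (norm_snd_le P) (abs_nonneg _) (norm_nonneg _)

lemma absNorm_add_le (P Q : V) : absNorm (P + Q) ≤ absNorm P + ‖Q‖ * (2 * ‖P‖ + ‖Q‖) := by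
  have hexpand : (P + Q).1 * (P + Q).2 = P.1 * P.2 + (Q.1 * P.2 + Q.2 * P.1 + Q.1 * Q.2) := by
    rw [Prod.fst_add, Prod.snd_add]
    ring
  calc absNorm (P + Q) ≤ |P.1 * P.2| + (|Q.1| * |P.2| + |Q.2| * |P.1| + |Q.1| * |Q.2|) := by
        rw [absNorm, hexpand, ← abs_mul, ← abs_mul, ← abs_mul]
        exact (abs_add_le _ _).trans (add_le_add_right (abs_add_three _ _ _) _)
    _ ≤ absNorm P + (‖Q‖ * ‖P‖ + ‖Q‖ * ‖P‖ + ‖Q‖ * ‖Q‖) := by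
        rw [absNorm]
        gcongr
        exacts [norm_fst_le Q, norm_snd_le P, norm_snd_le Q, norm_fst_le P, norm_fst_le Q,
          norm_snd_le Q]
    _ = absNorm P + ‖Q‖ * (2 * ‖P‖ + ‖Q‖) := by ring

lemma planeM_le (P : V) (Q : OK D) : planeM D P ≤ absNorm (P - embed D Q) :=
  ciInf_le ⟨0, forall_mem_range.2 fun _ => abs_nonneg _⟩ Q

lemma planeM_le_planeM_unitPt_mul (v : (OK D)ˣ) (P : V) :
    planeM D P ≤ planeM D (unitPt D v * P) := by
  refine le_ciInf fun Q => ?_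
  have hQ : P - embed D ((v⁻¹ : (OK D)ˣ) * Q : OK D) =
      unitPt D v⁻¹ * (unitPt D v * P - embed D Q) := by
    rw [mul_sub, unitPt_inv_mul_cancel_left, MulMemClass.coe_mul, map_mul]
    rfl
  rw [← absNorm_unitPt_mul v⁻¹, ← hQ]
  exact planeM_le P _

lemma M_phi (v : (OK D)ˣ) (p : Torus D) : M D (phi D v p) = M D p := by
  obtain ⟨P, rfl⟩ := exists_proj_eq p
  refine le_antisymm ?_ (planeM_le_planeM_unitPt_mul v P)
  have h := planeM_le_planeM_unitPt_mul v⁻¹ (unitPt D v * P)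
  rwa [unitPt_inv_mul_cancel_left] at h

lemma exists_absNorm_sub_lt {P : V} {t : ℝ} (h : planeM D P < t) :
    ∃ Q : OK D, absNorm (P - embed D Q) < t ∧ absNorm (P - embed D Q) ≤ absNorm P := by
  by_cases hP : absNorm P < t
  · exact ⟨0, by simpa using hP, by simp⟩
  · obtain ⟨Q, hQ⟩ := exists_lt_of_ciInf_lt h
    exact ⟨Q, hQ, (hQ.trans_le (not_lt.1 hP)).le⟩

lemma exists_zpow_balance {e x y : ℝ} (he : 1 < e) (hx : 0 ≤ x) (hy : 0 ≤ y) :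
    ∃ k : ℤ, (e ^ k)⁻¹ * x ≤ x * y + e ∧ e ^ k * y ≤ x * y + e := by
  have he0 : 0 < e := zero_lt_one.trans he
  have hxy : 0 ≤ x * y := mul_nonneg hx hy
  obtain rfl | hy := hy.eq_or_lt
  · obtain ⟨k, hk⟩ := pow_unbounded_of_one_lt x he
    refine ⟨k, ?_, by linarith⟩
    rw [inv_mul_le_iff₀ (by positivity), zpow_natCast]
    nlinarith
  · obtain ⟨m, hm, hm'⟩ := exists_mem_Ico_zpow (inv_pos.2 hy) he
    refine ⟨m + 1, ?_, ?_⟩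
    · have : (e ^ (m + 1))⁻¹ ≤ y := inv_le_of_inv_le₀ hy hm'.le
      nlinarith
    · have : e ^ m * y ≤ 1 := (le_inv_mul_iff₀' hy).1 (by simpa using hm)
      rw [zpow_add_one₀ he0.ne']
      nlinarith

lemma exists_norm_unitPt_zpow_mul_le (hu : 1 < (unitPt D ε).2) (P : V) :
    ∃ k : ℤ, ‖unitPt D (ε ^ k) * P‖ ≤ absNorm P + (unitPt D ε).2 := by
  obtain ⟨k, h1, h2⟩ := exists_zpow_balance hu (abs_nonneg P.1) (abs_nonneg P.2)
  refine ⟨k, ?_⟩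
  rw [norm_prod_le_iff, map_zpow, absNorm, abs_mul, Prod.fst_mul, Prod.snd_mul, Prod.pow_fst,
    Prod.pow_snd, norm_mul, norm_mul, norm_zpow, norm_zpow, Real.norm_eq_abs, abs_fst_unitPt hu,
    inv_zpow, Real.norm_of_nonneg (zero_lt_one.trans hu).le]
  exact ⟨h1, h2⟩

lemma finite_setOf_norm_embed_le (hD : 1 < D) (hsq : Squarefree D) (r : ℝ) :
    {Q : OK D | ‖embed D Q‖ ≤ r}.Finite := by
  have := discreteTopology_lattice hD hsq
  have hfin : (Metric.closedBall 0 r ∩ (lattice D : Set V)).Finite :=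
    Metric.finite_isBounded_inter_isClosed DiscreteTopology.isDiscrete
      Metric.isBounded_closedBall (isClosed_lattice hD hsq)
  refine (hfin.preimage (f := fun Q : OK D => embed D Q)
    (((embed_injective (by omega)).comp Subtype.val_injective).injOn)).subset fun Q hQ => ?_
  exact ⟨by simpa using hQ, embed_mem_lattice Q.2⟩

lemma exists_finset_bounded_witness (hD : 1 < D) (hsq : Squarefree D) (hu : 1 < (unitPt D ε).2)
    {S : Set V} (hS : Bornology.IsBounded S) :
    ∃ (I : Finset (OK D)) (B : ℝ), ∀ P ∈ S, ∀ t, M D (proj D P) < t →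
      ∃ k : ℤ, ∀ P' ∈ S, proj D P' = (phi D ε ^ k) (proj D P) →
        ∃ Q ∈ I, absNorm (P' - embed D Q) < t ∧ ‖P' - embed D Q‖ ≤ B := by
  obtain ⟨r, hr⟩ := hS.exists_norm_le
  set B := r ^ 2 + (unitPt D ε).2
  refine ⟨(finite_setOf_norm_embed_le hD hsq (r + B)).toFinset, B, fun P hP t ht => ?_⟩
  obtain ⟨Q, hQt, hQP⟩ := exists_absNorm_sub_lt ht
  obtain ⟨k, hk⟩ := exists_norm_unitPt_zpow_mul_le hu (P - embed D Q)
  refine ⟨k, fun P' hP' hPP' => ?_⟩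
  rw [phi_zpow, phi_proj, proj_eq_proj] at hPP'
  obtain ⟨q, hq, hqP⟩ := hPP'
  let Q' : OK D := (ε ^ k : (OK D)ˣ) * Q - ⟨q, hq⟩
  have hQ' : P' - embed D Q' = unitPt D (ε ^ k) * (P - embed D Q) := by
    have hembed : embed D Q' = unitPt D (ε ^ k) * embed D Q - (unitPt D (ε ^ k) * P - P') := by
      rw [← hqP, AddSubgroupClass.coe_sub, map_sub, MulMemClass.coe_mul, map_mul]
      rfl
    rw [hembed, mul_sub]
    abel
  have hB : ‖P' - embed D Q'‖ ≤ B := by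
    rw [hQ']
    have hPr : ‖P‖ ^ 2 ≤ r ^ 2 := by gcongr; exact hr P hP
    linarith [absNorm_le_norm_sq P]
  refine ⟨Q', ?_, by rwa [hQ', absNorm_unitPt_mul], hB⟩
  rw [Finite.mem_toFinset, mem_ofPred_eq, ← sub_sub_cancel P' (embed D Q')]
  exact (norm_sub_le _ _).trans (add_le_add (hr P' hP') hB)

end Minimum

/-! ### The two inclusions -/

section Inclusions

variable {D : ℕ} {ε : (OK D)ˣ}

lemma piPreimage_subset_sigmaAvoid (hD : 1 < D) (hsq : Squarefree D) (hu : 1 < (unitPt D ε).2)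
    (h5 : D = 5 → (unitPt D ε).2 ≤ α D) (n : ℕ) (t : ℝ) (I : Finset (OK D)) :
    piPreimage D ε (X D t) ⊆ sigmaAvoid D ε n (T D ε n t I) := by
  rintro s ⟨hs, p, hpt, hp⟩
  refine ⟨hs, ?_⟩
  rintro _ hw k rfl
  obtain ⟨P, hPp, hP⟩ := hp.exists_planar_iterate hD hsq hu h5 hs k
  rw [← window_shift_zero] at hw
  obtain ⟨Q, -, hQ⟩ := mem_iUnion₂.1 (hw.2 (hP n))
  have hM : M D p ≤ absNorm (P - embed D Q) := by
    rw [← M_phi (ε ^ k) p, ← phi_zpow, ← hPp]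
    exact planeM_le P Q
  exact (hpt.trans hM).not_gt hQ

lemma absNorm_sub_le_of_mem_closure_cylinder (hD : 1 < D) (hsq : Squarefree D)
    (hu : 1 < (unitPt D ε).2) (h5 : D = 5 → (unitPt D ε).2 ≤ α D) {s : ℤ → Letter D ε}
    (hs : s ∈ Sigma D ε) {n : ℕ} {P P' : V} (hP : P ∈ closure (cylinder s n))
    (hP' : P' ∈ closure (cylinder s n)) (Q : V) {δ : ℝ}
    (hδ : Metric.diam (footprint D) * (unitPt D ε).2⁻¹ ^ n ≤ δ) :
    absNorm (P' - Q) ≤ absNorm (P - Q) + δ * (2 * ‖P - Q‖ + δ) := by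
  have hdist : ‖P' - P‖ ≤ δ := by
    have hbdd := (isCompact_closure_cylinder s n).isBounded
    have hdiam := (diam_cylinder_le hD hsq hu h5 hs n).trans hδ
    rw [← Metric.diam_closure] at hdiam
    exact (Metric.dist_le_diam_of_mem hbdd hP' hP).trans hdiam
  have hδ_nonneg : 0 ≤ δ := (norm_nonneg _).trans hdist
  calc absNorm (P' - Q) = absNorm (P - Q + (P' - P)) := by congr 1; abel
    _ ≤ absNorm (P - Q) + ‖P' - P‖ * (2 * ‖P - Q‖ + ‖P' - P‖) := absNorm_add_le _ _
    _ ≤ absNorm (P - Q) + δ * (2 * ‖P - Q‖ + δ) := by gcongr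

lemma exists_finset_sigmaAvoid_subset (hD : 1 < D) (hsq : Squarefree D)
    (hu : 1 < (unitPt D ε).2) (h5 : D = 5 → (unitPt D ε).2 ≤ α D) :
    ∃ I_K : Finset (OK D), ∀ I, I_K ⊆ I → ∀ t' t, t' < t →
      ∀ᶠ n : ℕ in atTop, sigmaAvoid D ε n (T D ε n t I) ⊆ piPreimage D ε (X D t') := by
  obtain ⟨I_K, B, hwit⟩ :=
    exists_finset_bounded_witness hD hsq hu (isBounded_footprint D).closure
  refine ⟨I_K, fun I hI t' t htt => ?_⟩
  have hδ := tendsto_diam_footprint_mul_pow hu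
  set δ := fun n : ℕ => Metric.diam (footprint D) * (unitPt D ε).2⁻¹ ^ n
  have hlim : Tendsto (fun n => δ n * (2 * B + δ n)) atTop (𝓝 0) := by
    simpa using hδ.mul (hδ.const_add (2 * B))
  filter_upwards [hlim.eventually_lt_const (sub_pos.2 htt)] with n hn
  rintro s ⟨hs, havoid⟩
  have mem_closure_footprint {s : ℤ → Letter D ε} {P : V} (hP : ∀ n, P ∈ closure (cylinder s n)) :
      P ∈ closure (footprint D) := closure_mono inter_subset_right (hP 0)
  obtain ⟨P₀, hP₀, hp⟩ := exists_isCoded_proj hD hsq hu h5 hs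
  refine ⟨hs, _, ?_, hp⟩
  by_contra hlt
  obtain ⟨k, hk⟩ := hwit P₀ (mem_closure_footprint hP₀) t' (not_le.1 hlt)
  obtain ⟨P, hPp, hP⟩ := hp.exists_planar_iterate hD hsq hu h5 hs k
  obtain ⟨Q, hQI, hQt, hQB⟩ := hk P (mem_closure_footprint hP) hPp
  have hs' := shift_mem_sigma hs k
  refine havoid (window s k n) ⟨⟨?_, _, rfl⟩, ?_⟩ k rfl
  · rw [← window_shift_zero, ← image_proj_cylinder hD hsq]
    exact (nonempty_cylinder hD hsq hu h5 hs' n).image _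
  rw [← window_shift_zero]
  intro Y hY
  refine mem_iUnion₂.2 ⟨Q, hI hQI, ?_⟩
  calc absNorm (Y - embed D Q)
      ≤ absNorm (P - embed D Q) + δ n * (2 * ‖P - embed D Q‖ + δ n) :=
        absNorm_sub_le_of_mem_closure_cylinder hD hsq hu h5 hs' (hP n) hY _ le_rfl
    _ ≤ absNorm (P - embed D Q) + δ n * (2 * B + δ n) := by gcongr
    _ < t := by linarith

end Inclusions

end RealQuadraticTorus

end

open RealQuadraticTorus in
theorem proposition2_general (D : ℕ) (hD : 1 < D) (hsq : Squarefree D) (ε : (OK D)ˣ)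
    (hε : 1 < (embed D ((ε : OK D) : K D)).2) (h5 : D = 5 → IsFundamentalUnit D ε) :
    ∃ I_K : Finset (OK D), ∀ I : Finset (OK D), I_K ⊆ I →
      (∀ t' t : ℝ, t' < t → ∀ᶠ n : ℕ in atTop,
        piPreimage D ε (X D t) ⊆ sigmaAvoid D ε n (T D ε n t I) ∧
          sigmaAvoid D ε n (T D ε n t I) ⊆ piPreimage D ε (X D t')) ∧
      (∀ t : ℝ, piPreimage D ε (X D t) = ⋂ n : ℕ, sigmaAvoid D ε n (T D ε n t I)) := by
  have hle : D = 5 → (unitPt D ε).2 ≤ α D := by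
    rintro rfl
    exact (h5 rfl).snd_unitPt_le_α
  have hsub := piPreimage_subset_sigmaAvoid hD hsq hε hle
  obtain ⟨I_K, hI_K⟩ := exists_finset_sigmaAvoid_subset hD hsq hε hle
  refine ⟨I_K, fun I hI => ⟨fun t' t htt => ?_, fun t => ?_⟩⟩
  · exact (hI_K I hI t' t htt).mono fun n hn => ⟨hsub n t I, hn⟩
  refine Subset.antisymm (subset_iInter fun n => hsub n t I) fun s hs => ?_
  rw [mem_iInter] at hs
  have hsigma : s ∈ Sigma D ε := (hs 0).1
  obtain ⟨P, -, hP⟩ := exists_isCoded_proj hD hsq hε hle hsigma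
  have ht : t ≤ M D (proj D P) := le_of_forall_lt fun t₀ ht₀ => by
    obtain ⟨t', ht₀t', ht'⟩ := exists_between ht₀
    obtain ⟨n, hn⟩ := (hI_K I hI t' t ht').exists
    obtain ⟨-, q, hq, hqs⟩ := hn (hs n)
    rw [hP.unique hqs]
    exact ht₀t'.trans_le hq
  exact ⟨hsigma, _, ht, hP⟩

theorem proposition2 (D : ℕ) (hD : 1 < D) (hsq : Squarefree D)
    (ε : (RealQuadraticTorus.OK D)ˣ) (hε : RealQuadraticTorus.IsFundamentalUnit D ε) :
    ∃ I_K : Finset (RealQuadraticTorus.OK D), ∀ I : Finset (RealQuadraticTorus.OK D), I_K ⊆ I →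
      (∀ t' t : ℝ, t' < t → ∀ᶠ n : ℕ in atTop,
        RealQuadraticTorus.piPreimage D ε (RealQuadraticTorus.X D t) ⊆
            RealQuadraticTorus.sigmaAvoid D ε n (RealQuadraticTorus.T D ε n t I) ∧
          RealQuadraticTorus.sigmaAvoid D ε n (RealQuadraticTorus.T D ε n t I) ⊆
            RealQuadraticTorus.piPreimage D ε (RealQuadraticTorus.X D t')) ∧
      (∀ t : ℝ, RealQuadraticTorus.piPreimage D ε (RealQuadraticTorus.X D t) =
        ⋂ n : ℕ, RealQuadraticTorus.sigmaAvoid D ε n (RealQuadraticTorus.T D ε n t I)) := by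
  exact proposition2_general D hD hsq ε hε.1 fun _ => hε
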